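/- $\mathsf{RCA}_0$ proves the following. Let $Q=(Q,\leq_Q)$ be a quasi-order (a set $Q\subseteq\mathbb N$ with a reflexive and transitive relation $\leq_Q$ on it that is also a set). (i) If $\mathrm{alex}(Q)$ is Noetherian, then $\mathrm{upper}(Q)$ is Noetherian. (ii) $Q$ is a wqo if and only if $\mathrm{alex}(Q)$ is Noetherian. Here "$\mathsf{RCA}_0$ proves" means: the assertion is true in every model $(M,S)$ of $\mathsf{RCA}_0$ (equivalently, by Gödel's completeness theorem, derivable from $\mathsf{RCA}_0$), where $M$ is a possibly nonstandard first-order part, $S\subseteq\mathcal P(M)$ is the range of the set variables, and the axioms of $\mathsf{RCA}_0$ are those of a discretely ordered commutative semiring with identity (with all elements nonnegative and with differences $y-x$ for $x<y$), $\Sigma^0_1$ induction and $\Delta^0_1$ comprehension, both with arbitrary number and set parameters. All notions below are interpreted in $(M,S)$, with $\mathbb N$ standing for $M$ and all sets and functions belonging to $S$; pairs are coded by $(i,j)=(i+j)^2+i$, and a finite set is coded by the least triple $(k,(m,n))$ for which the set is $\{i<k : m(i+1)+1 \text{ divides } n\}$. $\mathcal P_{\mathrm f}(A)$ denotes the set of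 codes of finite subsets of $A$. * $Q$ is a *wqo* if for every function $f:\mathbb N\to Q$ there are $m<n$ with $f(m)\leq_Q f(n)$. * A *countable second-countable space* is a triple $(X,(U_i)_{i\in I},k)$ with $U_i\subseteq X$ and $k:X\times I\times I\to I$, such that every $x\in X$ is in some $U_i$, and $x\in U_i\cap U_j$ implies $x\in U_{k(x,i,j)}\subseteq U_i\cap U_j$. A function $h:\mathbb N\to\mathcal P_{\mathrm f}(I)$ codes the effectively open set $G_h=\bigcup_{n}\bigcup_{i\in h(n)}U_i$ (as a formula; it need not exist as a set). $G_h$ is *compact* if for every $f:\mathbb N\to\mathcal P_{\mathrm f}(I)$ with $G_h\subseteq G_f$ there is an $N$ with $G_h\subseteq\bigcup_{n<N}\bigcup_{i\in f(n)}U_i$. The space is *Noetherian* if every effectively open set is compact. * $\mathrm{alex}(Q)$ is the space $(Q,(U_q)_{q\in Q},k)$ with $U_q=\{x\in Q: q\leq_Q x\}$ and $k(q,p,r)=q$. * $\mathrm{upper}(Q)$ is the space $(Q,(V_c)_{c\in\mathcal P_{\mathrm f}(Q)},\ell)$ with $V_c=\{x\in Q: x\not\leq_Q p\text{ for all }p\in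 c\}$ and $\ell(q,c,d)=c\cup d$. -/

import Mathlib

/-! Second-order arithmetic. A structure for its two-sorted language consists of a first-order part
`M` (with `0, 1, +, *, <`) and a family `S : Set (Set M)` over which the set variables range. -/

namespace SOA

universe u

/-! ### Bounded-quantifier formulas of second-order arithmetic -/

/-- Numerical terms; `var n` is the number variable with de Bruijn index `n`. -/
inductive NumTerm : Type
  | var (n : ℕ)
  | zero
  | one
  | add (s t : NumTerm)
  | mul (s t : NumTerm)

/-- Formulas of second-order arithmetic all of whose quantifiers are bounded number quantifiers
(`Δ⁰₀` formulas). Set variables `i : ℕ` occur only as parameters, in the atoms `t ∈ X_i`. In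
`ball t φ` (`∀ x < t, φ`) and `bex t φ` (`∃ x < t, φ`) the bound variable is the variable `0` of
`φ`, and `t` belongs to the outer context (so `x` does not occur in `t`). -/
inductive BddFormula : Type
  | eq (s t : NumTerm)
  | lt (s t : NumTerm)
  | mem (t : NumTerm) (i : ℕ)
  | neg (φ : BddFormula)
  | and (φ ψ : BddFormula)
  | or (φ ψ : BddFormula)
  | ball (t : NumTerm) (φ : BddFormula)
  | bex (t : NumTerm) (φ : BddFormula)

/-- Extend an assignment of the number variables by a new value for the variable `0`. -/
def push {M : Type u} (a : M) (v : ℕ → M) : ℕ → M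
  | 0 => a
  | n + 1 => v n

section Semantics

variable {M : Type u} [CommSemiring M] [LinearOrder M]

/-- The value of a term. -/
def NumTerm.eval (v : ℕ → M) : NumTerm → M
  | .var n => v n
  | .zero => 0
  | .one => 1
  | .add s t => s.eval v + t.eval v
  | .mul s t => s.eval v * t.eval v

/-- Truth of a bounded-quantifier formula in `M`, under an assignment `V` of the set variables and
an assignment `v` of the number variables. -/
def BddFormula.Holds (V : ℕ → Set M) : BddFormula → (ℕ → M) → Prop
  | .eq s t, v => s.eval v = t.eval v
  | .lt s t, v => s.eval v < t.eval v
  | .mem t i, v => t.eval v ∈ V i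
  | .neg φ, v => ¬ φ.Holds V v
  | .and φ ψ, v => φ.Holds V v ∧ ψ.Holds V v
  | .or φ ψ, v => φ.Holds V v ∨ ψ.Holds V v
  | .ball t φ, v => ∀ a, a < t.eval v → φ.Holds V (push a v)
  | .bex t φ, v => ∃ a, a < t.eval v ∧ φ.Holds V (push a v)

/-- The `Σ⁰₁` formula `∃ m θ(m, n)` at the argument `n`; the other variables are parameters. -/
def SigmaHolds (θ : BddFormula) (V : ℕ → Set M) (v : ℕ → M) (n : M) : Prop :=
  ∃ m, θ.Holds V (push m (push n v))

/-- The `Π⁰₁` formula `∀ m θ(m, n)` at the argument `n`; the other variables are parameters. -/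
def PiHolds (θ : BddFormula) (V : ℕ → Set M) (v : ℕ → M) (n : M) : Prop :=
  ∀ m, θ.Holds V (push m (push n v))

end Semantics

/-- `(M, S)` is a model of `RCA₀`: `M` is a discretely ordered commutative semiring (its elements are
all nonnegative, and smaller elements can be subtracted from larger ones), and `(M, S)` satisfies
every instance, with arbitrary number and set parameters, of `Σ⁰₁` induction and of `Δ⁰₁`
comprehension. `M` need not be the standard `ℕ`, and `S` need not contain all subsets of `M`. -/
structure IsModelRCA0 (M : Type u) [CommSemiring M] [LinearOrder M] [IsStrictOrderedRing M]
    (S : Set (Set M)) : Prop where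
  zero_le : ∀ x : M, 0 ≤ x
  lt_iff_add_one_le : ∀ x y : M, x < y ↔ x + 1 ≤ y
  exists_add_of_lt : ∀ x y : M, x < y → ∃ z, x + z = y
  /-- The range of the set variables is nonempty, as in any two-sorted structure. -/
  sets_nonempty : S.Nonempty
  sigma_induction : ∀ (θ : BddFormula) (V : ℕ → Set M) (v : ℕ → M), (∀ i, V i ∈ S) →
    SigmaHolds θ V v 0 → (∀ n, SigmaHolds θ V v n → SigmaHolds θ V v (n + 1)) →
    ∀ n, SigmaHolds θ V v n
  delta_comprehension : ∀ (θ η : BddFormula) (V : ℕ → Set M) (v : ℕ → M), (∀ i, V i ∈ S) →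
    (∀ n, SigmaHolds θ V v n ↔ PiHolds η V v n) → {n | SigmaHolds θ V v n} ∈ S

/-! ### Codes for pairs, finite sets and functions

From here on everything is spelled out inside a structure `(M, S)`: "number" means element of `M`,
and "set" means member of `S`. -/

section Coding

variable {M : Type u} [CommSemiring M] [LinearOrder M]

/-- The code `(i + j)² + i` of the ordered pair `(i, j)`. -/
def pair (i j : M) : M := (i + j) * (i + j) + i

/-- The set of (codes of) pairs with components in `A` and `B`. -/
def prodSet (A B : Set M) : Set M := {z | ∃ a ∈ A, ∃ b ∈ B, z = pair a b}

/-- `c` is of the form `(k, (m, n))`. -/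
def IsTriple (c : M) : Prop := ∃ k m n : M, c = pair k (pair m n)

/-- `i` is an element of the finite set represented by `c = (k, (m, n))`, which is
`{i < k : m (i + 1) + 1 divides n}`. -/
def FinMem (i c : M) : Prop :=
  ∃ k m n : M, c = pair k (pair m n) ∧ i < k ∧ m * (i + 1) + 1 ∣ n

/-- `c` is the code of a finite set: the least number that represents it. -/
def IsFinCode (c : M) : Prop :=
  IsTriple c ∧ ∀ d, d < c → IsTriple d → ¬ ∀ i, FinMem i d ↔ FinMem i c

/-- The set of codes of finite subsets of `A`. -/
def Pfin (A : Set M) : Set M := {c | IsFinCode c ∧ ∀ i, FinMem i c → i ∈ A}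

/-- `f` is (the graph of) a function from `A` to `B`. -/
def IsFun (A B f : Set M) : Prop :=
  f ⊆ prodSet A B ∧ ∀ a ∈ A, ∃! b, b ∈ B ∧ pair a b ∈ f

/-! ### Quasi-orders -/

/-- `(Q, L)` is a quasi-order of the structure `(M, S)`; `p ≤ q` means `pair p q ∈ L`. -/
structure IsQuasiOrder (S : Set (Set M)) (Q L : Set M) : Prop where
  carrier_mem : Q ∈ S
  rel_mem : L ∈ S
  rel_subset : L ⊆ prodSet Q Q
  refl : ∀ q ∈ Q, pair q q ∈ L
  trans : ∀ p ∈ Q, ∀ q ∈ Q, ∀ r ∈ Q, pair p q ∈ L → pair q r ∈ L → pair p r ∈ L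

/-- `(Q, L)` is a well-quasi-order in `(M, S)`: for every function `f : M → Q` in `S` there are
`m < n` with `f m ≤ f n`. -/
def IsWQO (S : Set (Set M)) (Q L : Set M) : Prop :=
  IsQuasiOrder S Q L ∧ ∀ f ∈ S, IsFun Set.univ Q f →
    ∃ m n a b, m < n ∧ pair m a ∈ f ∧ pair n b ∈ f ∧ pair a b ∈ L

/-! ### Countable second-countable spaces -/

/-- The data of a countable second-countable space: the set `X` of points, the index set `I`, the
sequence `(U_i)` coded by `U = {(x, i) : x ∈ U_i}`, and the function `k : X × I × I → I`. -/
structure CSC (M : Type u) where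
  X : Set M
  I : Set M
  U : Set M
  k : Set M

/-- The data belong to `(M, S)`, and `((U_i), k)` is a base for a topology on `X`. -/
structure CSC.IsSpace (S : Set (Set M)) (D : CSC M) : Prop where
  X_mem : D.X ∈ S
  I_mem : D.I ∈ S
  U_mem : D.U ∈ S
  k_mem : D.k ∈ S
  U_subset : D.U ⊆ prodSet D.X D.I
  k_fun : IsFun (prodSet D.X (prodSet D.I D.I)) D.I D.k
  cover : ∀ x ∈ D.X, ∃ i ∈ D.I, pair x i ∈ D.U
  inter : ∀ x ∈ D.X, ∀ i ∈ D.I, ∀ j ∈ D.I, ∀ l ∈ D.I,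
    pair x i ∈ D.U → pair x j ∈ D.U → pair (pair x (pair i j)) l ∈ D.k →
    pair x l ∈ D.U ∧ ∀ y, pair y l ∈ D.U → pair y i ∈ D.U ∧ pair y j ∈ D.U

/-- `h` codes an effectively open set: it is a function in `S` from numbers to finite subsets
of `I`. -/
def CSC.IsOpenCode (S : Set (Set M)) (D : CSC M) (h : Set M) : Prop :=
  h ∈ S ∧ IsFun Set.univ (Pfin D.I) h

/-- `x` belongs to the union of the `U_i` with `i ∈ h(n)`. -/
def CSC.MemAt (D : CSC M) (h : Set M) (x n : M) : Prop :=
  ∃ c i, pair n c ∈ h ∧ FinMem i c ∧ pair x i ∈ D.U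

/-- `x ∈ G_h`, where `G_h` is the union over all `n` and all `i ∈ h(n)` of `U_i`. -/
def CSC.MemOpen (D : CSC M) (h : Set M) (x : M) : Prop := ∃ n, D.MemAt h x n

/-- The effectively open set `G_h` is compact. -/
def CSC.IsCompactOpen (S : Set (Set M)) (D : CSC M) (h : Set M) : Prop :=
  ∀ f, D.IsOpenCode S f → (∀ x, D.MemOpen h x → D.MemOpen f x) →
    ∃ N, ∀ x, D.MemOpen h x → ∃ n, n < N ∧ D.MemAt f x n

/-- A countable second-countable space is Noetherian if every effectively open set is compact. -/
def CSC.IsNoetherian (S : Set (Set M)) (D : CSC M) : Prop :=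
  D.IsSpace S ∧ ∀ h, D.IsOpenCode S h → D.IsCompactOpen S h

/-- The Alexandroff topology of `(Q, L)`: `I = Q`, `U_q = {x ∈ Q : q ≤ x}` and `k(q, p, r) = q`. -/
def alex (Q L : Set M) : CSC M where
  X := Q
  I := Q
  U := {z | ∃ x ∈ Q, ∃ q ∈ Q, z = pair x q ∧ pair q x ∈ L}
  k := {z | ∃ q ∈ Q, ∃ p ∈ Q, ∃ r ∈ Q, z = pair (pair q (pair p r)) q}

/-- The upper topology of `(Q, L)`: the index set consists of (the codes of) the finite subsets of
`Q`, `U_c = {x ∈ Q : ¬ x ≤ p for every p ∈ c}` and `k(q, c, d) = c ∪ d`. -/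
def upper (Q L : Set M) : CSC M where
  X := Q
  I := Pfin Q
  U := {z | ∃ x ∈ Q, ∃ c ∈ Pfin Q, z = pair x c ∧ ∀ p, FinMem p c → pair x p ∉ L}
  k := {z | ∃ q ∈ Q, ∃ c ∈ Pfin Q, ∃ d ∈ Pfin Q, ∃ e ∈ Pfin Q,
    z = pair (pair q (pair c d)) e ∧ ∀ i, FinMem i e ↔ FinMem i c ∨ FinMem i d}

end Coding

end SOA

set_option linter.unusedSectionVars false

namespace SOA

universe u

/-! ### Renaming of variables -/

/-! Each basic set `V_c` of the upper topology is upward closed, so an upper-open set is the union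
of the cones `U_q` of its own points. Listing `q` at stage `pair q m` whenever `q` is found at stage
`m` gives an Alexandroff code of the same set (`exists_alex_code`). Since `m ≤ pair q m`, a bound on
the Alexandroff stages of a cover also bounds its upper stages, which gives (i).

For (ii), let `alex Q L` be Noetherian and `g` a sequence in `Q`. The union of the cones of the
values of `g`, covered by its own code, has a bound `N`. The point `g N` then lies in the cone of
some `g m` with `m < N`. Conversely, suppose that no finite part of a cover suffices. Then a
sequence `b 0 ≤ b 1 ≤ ...` and points `X n` can be chosen so that `X n` is covered before stage `b
(n + 1)` but not before stage `b n`. If `m < n` and `X m ≤ X n`, the cone that covers `X m` also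
covers `X n`, before stage `b (m + 1) ≤ b n`, a contradiction. So the sequence `X` is bad.

The rest is what these arguments need inside a model of `RCA₀`. The classes `IsBdd`, `IsSigma` and
`IsDelta` describe definability semantically, so that induction and comprehension apply to ordinary
Lean predicates. From them come codes of bounded sets by Gödel's β function (`exists_code`), choice
for total `Σ⁰₁` relations (`exists_choice`) and iteration (`exists_iterate`). -/

/-- Lift a renaming under a quantifier. -/
def liftRen (ρ : ℕ → ℕ) : ℕ → ℕ
  | 0 => 0
  | n + 1 => ρ n + 1

def NumTerm.rename (ρ : ℕ → ℕ) : NumTerm → NumTerm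
  | .var n => .var (ρ n)
  | .zero => .zero
  | .one => .one
  | .add s t => .add (s.rename ρ) (t.rename ρ)
  | .mul s t => .mul (s.rename ρ) (t.rename ρ)

def BddFormula.rename (σ : ℕ → ℕ) : BddFormula → (ℕ → ℕ) → BddFormula
  | .eq s t, ρ => .eq (s.rename ρ) (t.rename ρ)
  | .lt s t, ρ => .lt (s.rename ρ) (t.rename ρ)
  | .mem t i, ρ => .mem (t.rename ρ) (σ i)
  | .neg φ, ρ => .neg (φ.rename σ ρ)
  | .and φ ψ, ρ => .and (φ.rename σ ρ) (ψ.rename σ ρ)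
  | .or φ ψ, ρ => .or (φ.rename σ ρ) (ψ.rename σ ρ)
  | .ball t φ, ρ => .ball (t.rename ρ) (φ.rename σ (liftRen ρ))
  | .bex t φ, ρ => .bex (t.rename ρ) (φ.rename σ (liftRen ρ))

theorem push_comp_liftRen {M : Type u} (a : M) (v : ℕ → M) (ρ : ℕ → ℕ) :
    push a v ∘ liftRen ρ = push a (v ∘ ρ) := by
  funext n; cases n <;> rfl

theorem NumTerm.eval_rename {M : Type u} [CommSemiring M] (ρ : ℕ → ℕ) (v : ℕ → M) (t : NumTerm) :
    (t.rename ρ).eval v = t.eval (v ∘ ρ) := by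
  induction t with
  | var n => rfl
  | zero => rfl
  | one => rfl
  | add s t hs ht => simp [rename, eval, hs, ht]
  | mul s t hs ht => simp [rename, eval, hs, ht]

theorem BddFormula.holds_rename {M : Type u} [CommSemiring M] [LinearOrder M] (σ : ℕ → ℕ) (V : ℕ → Set M) (φ : BddFormula) :
    ∀ (ρ : ℕ → ℕ) (v : ℕ → M), (φ.rename σ ρ).Holds V v ↔ φ.Holds (V ∘ σ) (v ∘ ρ) := by
  induction φ with
  | eq s t => intro ρ v; simp [rename, Holds, NumTerm.eval_rename]
  | lt s t => intro ρ v; simp [rename, Holds, NumTerm.eval_rename]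
  | mem t i => intro ρ v; simp [rename, Holds, NumTerm.eval_rename]
  | neg φ h => intro ρ v; simp [rename, Holds, h]
  | and φ ψ h h' => intro ρ v; simp [rename, Holds, h, h']
  | or φ ψ h h' => intro ρ v; simp [rename, Holds, h, h']
  | ball t φ h => intro ρ v; simp [rename, Holds, h, NumTerm.eval_rename, push_comp_liftRen]
  | bex t φ h => intro ρ v; simp [rename, Holds, h, NumTerm.eval_rename, push_comp_liftRen]

/-! ### Polynomial functions and bounded predicates with parameters -/

section

variable {M : Type u} [CommSemiring M]

/-- Polynomial functions of an assignment, with parameters from `M`. -/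
inductive IsPoly : ((ℕ → M) → M) → Prop
  | var (i : ℕ) : IsPoly fun v => v i
  | const (c : M) : IsPoly fun _ => c
  | add {s t : (ℕ → M) → M} : IsPoly s → IsPoly t → IsPoly fun v => s v + t v
  | mul {s t : (ℕ → M) → M} : IsPoly s → IsPoly t → IsPoly fun v => s v * t v

/-- Predicates of an assignment defined by bounded-quantifier formulas with parameters from `M`
and `S`. -/
inductive IsBdd [LinearOrder M] (S : Set (Set M)) : ((ℕ → M) → Prop) → Prop
  | eq {s t : (ℕ → M) → M} : IsPoly s → IsPoly t → IsBdd S fun v => s v = t v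
  | lt {s t : (ℕ → M) → M} : IsPoly s → IsPoly t → IsBdd S fun v => s v < t v
  | mem {t : (ℕ → M) → M} {A : Set M} : IsPoly t → A ∈ S → IsBdd S fun v => t v ∈ A
  | not {P : (ℕ → M) → Prop} : IsBdd S P → IsBdd S fun v => ¬ P v
  | and {P R : (ℕ → M) → Prop} : IsBdd S P → IsBdd S R → IsBdd S fun v => P v ∧ R v
  | or {P R : (ℕ → M) → Prop} : IsBdd S P → IsBdd S R → IsBdd S fun v => P v ∨ R v
  | ball_push {t : (ℕ → M) → M} {P : (ℕ → M) → Prop} : IsPoly t → IsBdd S P →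
      IsBdd S fun v => ∀ a, a < t v → P (push a v)
  | bex_push {t : (ℕ → M) → M} {P : (ℕ → M) → Prop} : IsPoly t → IsBdd S P →
      IsBdd S fun v => ∃ a, a < t v ∧ P (push a v)

/-- The assignment with `v` at the even and `p` at the odd places. -/
def mix {α : Type u} (v p : ℕ → α) (n : ℕ) : α := if n % 2 = 0 then v (n / 2) else p (n / 2)

theorem mix_even {α : Type u} (v p : ℕ → α) (n : ℕ) : mix v p (2 * n) = v n := by
  simp [mix]

theorem mix_odd {α : Type u} (v p : ℕ → α) (n : ℕ) : mix v p (2 * n + 1) = p n := by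
  have h : (2 * n + 1) / 2 = n := by omega
  simp [mix, h, Nat.add_mod]

/-- The renaming that passes from parameters `p ∘ e` to parameters `p`. -/
def paramRen (e : ℕ → ℕ) (n : ℕ) : ℕ := if n % 2 = 0 then n else 2 * e (n / 2) + 1

theorem mix_comp_paramRen {α : Type u} (v p : ℕ → α) (e : ℕ → ℕ) :
    mix v p ∘ paramRen e = mix v (p ∘ e) := by
  funext n
  by_cases h : n % 2 = 0
  · simp [paramRen, mix, h]
  · simp only [Function.comp, paramRen, h, if_false, mix_odd]
    simp [mix, h]

/-- The renaming that passes from `mix (push a v) p` to `push a (mix v p)`. -/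
def quantRen (n : ℕ) : ℕ := if n = 0 then 0 else if n % 2 = 0 then n - 1 else n + 1

theorem push_mix_comp_quantRen {α : Type u} (a : α) (v p : ℕ → α) :
    push a (mix v p) ∘ quantRen = mix (push a v) p := by
  funext n
  obtain ⟨m, rfl | rfl⟩ := Nat.even_or_odd' n
  · cases m with
    | zero => rfl
    | succ m =>
      have h : quantRen (2 * (m + 1)) = 2 * m + 1 := by simp [quantRen]; omega
      rw [mix_even, Function.comp, h]
      exact mix_even v p m
  · have h : quantRen (2 * m + 1) = (2 * m + 1) + 1 := by simp [quantRen, Nat.add_mod]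
    rw [mix_odd, Function.comp, h]
    exact mix_odd v p m

theorem mix_comp_two_mul {α : Type u} (p q : ℕ → α) : (mix p q ∘ fun n => 2 * n) = p :=
  funext fun n => mix_even p q n

theorem mix_comp_two_mul_add_one {α : Type u} (p q : ℕ → α) :
    (mix p q ∘ fun n => 2 * n + 1) = q :=
  funext fun n => mix_odd p q n

/-- `τ` with parameters `p` defines `t`. -/
def TermDefines (τ : NumTerm) (p : ℕ → M) (t : (ℕ → M) → M) : Prop :=
  ∀ v, t v = τ.eval (mix v p)

theorem TermDefines.rename {τ : NumTerm} {e : ℕ → ℕ} {p : ℕ → M} {t : (ℕ → M) → M}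
    (h : TermDefines τ (p ∘ e) t) : TermDefines (τ.rename (paramRen e)) p t := fun v => by
  rw [NumTerm.eval_rename, mix_comp_paramRen, h v]

/-- Two terms can be combined only under a common assignment of parameters; interleaving the two
parameter sequences supplies one. -/
theorem exists_termDefines₂ {τ σ : NumTerm} {p q : ℕ → M} {s t : (ℕ → M) → M}
    (h : TermDefines τ p s) (h' : TermDefines σ q t) :
    ∃ τ σ r, TermDefines τ r s ∧ TermDefines σ r t := by
  rw [← mix_comp_two_mul p q] at h
  rw [← mix_comp_two_mul_add_one p q] at h'
  exact ⟨_, _, _, h.rename, h'.rename⟩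

theorem IsPoly.exists_termDefines {t : (ℕ → M) → M} (h : IsPoly t) :
    ∃ τ p, TermDefines τ p t := by
  induction h with
  | var i => exact ⟨.var (2 * i), fun _ => 0, fun v => (mix_even v _ i).symm⟩
  | const c => exact ⟨.var (2 * 0 + 1), fun _ => c, fun v => (mix_odd v (fun _ => c) 0).symm⟩
  | add _ _ h h' =>
    obtain ⟨τ, p, h⟩ := h
    obtain ⟨σ, q, h'⟩ := h'
    obtain ⟨τ, σ, r, h, h'⟩ := exists_termDefines₂ h h'
    exact ⟨.add τ σ, r, fun v => by simp only [NumTerm.eval, h v, h' v]⟩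
  | mul _ _ h h' =>
    obtain ⟨τ, p, h⟩ := h
    obtain ⟨σ, q, h'⟩ := h'
    obtain ⟨τ, σ, r, h, h'⟩ := exists_termDefines₂ h h'
    exact ⟨.mul τ σ, r, fun v => by simp only [NumTerm.eval, h v, h' v]⟩

theorem IsPoly.comp {t : (ℕ → M) → M} (h : IsPoly t) {σ : (ℕ → M) → ℕ → M}
    (hσ : ∀ n, IsPoly fun v => σ v n) : IsPoly fun v => t (σ v) := by
  induction h with
  | var i => exact hσ i
  | const c => exact .const c
  | add _ _ h h' => exact .add h h'
  | mul _ _ h h' => exact .mul h h'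

theorem IsPoly.tail {t : (ℕ → M) → M} (h : IsPoly t) : IsPoly fun v => t (fun n => v (n + 1)) :=
  h.comp fun n => .var (n + 1)

theorem IsPoly.pair {s t : (ℕ → M) → M} (hs : IsPoly s) (ht : IsPoly t) :
    IsPoly fun v => pair (s v) (t v) :=
  .add (.mul (.add hs ht) (.add hs ht)) hs

theorem IsPoly.push {t : (ℕ → M) → M} {σ : (ℕ → M) → ℕ → M} (ht : IsPoly t)
    (hσ : ∀ n, IsPoly fun v => σ v n) (n : ℕ) : IsPoly fun v => push (t v) (σ v) n := by
  cases n with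
  | zero => exact ht
  | succ n => exact hσ n

end

section

variable {M : Type u} [CommSemiring M] [LinearOrder M] {S : Set (Set M)}

/-- `θ` with parameters `V` and `p` defines `P`. -/
def FormulaDefines (θ : BddFormula) (V : ℕ → Set M) (p : ℕ → M) (P : (ℕ → M) → Prop) : Prop :=
  ∀ v, P v ↔ θ.Holds V (mix v p)

theorem FormulaDefines.rename {θ : BddFormula} {e f : ℕ → ℕ} {V : ℕ → Set M} {p : ℕ → M}
    {P : (ℕ → M) → Prop} (h : FormulaDefines θ (V ∘ f) (p ∘ e) P) :
    FormulaDefines (θ.rename f (paramRen e)) V p P := fun v => by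
  rw [BddFormula.holds_rename, mix_comp_paramRen, h v]

theorem exists_formulaDefines₂ {θ η : BddFormula} {V W : ℕ → Set M} {p q : ℕ → M}
    {P R : (ℕ → M) → Prop} (hV : ∀ i, V i ∈ S) (hW : ∀ i, W i ∈ S)
    (h : FormulaDefines θ V p P) (h' : FormulaDefines η W q R) :
    ∃ θ η U r, (∀ i, U i ∈ S) ∧ FormulaDefines θ U r P ∧ FormulaDefines η U r R := by
  rw [← mix_comp_two_mul p q, ← mix_comp_two_mul V W] at h
  rw [← mix_comp_two_mul_add_one p q, ← mix_comp_two_mul_add_one V W] at h'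
  refine ⟨_, _, _, _, fun i => ?_, h.rename, h'.rename⟩
  unfold mix
  split
  exacts [hV _, hW _]

/-- A quantifier puts its variable in front of the variables and parameters already mixed together.
`quantRen` restores the parity convention of `mix`. -/
theorem exists_quantifierDefines {τ : NumTerm} {θ : BddFormula} {V : ℕ → Set M} {p q : ℕ → M}
    {t : (ℕ → M) → M} {P : (ℕ → M) → Prop}
    (h : TermDefines τ p t) (h' : FormulaDefines θ V q P) :
    ∃ τ θ r, TermDefines τ r t ∧ ∀ a v, P (push a v) ↔ BddFormula.Holds V θ (push a (mix v r)) := by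
  rw [← mix_comp_two_mul p q] at h
  rw [← mix_comp_two_mul_add_one p q] at h'
  refine ⟨_, (θ.rename id (paramRen fun n => 2 * n + 1)).rename id quantRen, _, h.rename,
    fun a v => ?_⟩
  rw [BddFormula.holds_rename, push_mix_comp_quantRen]
  exact FormulaDefines.rename (V := V) (f := id) h' _

/-- This is the bridge from semantic definability to the formulas in the axioms. A member of `S` is
needed even when no set parameter occurs, to fill the assignment of set variables. -/
theorem IsBdd.exists_formulaDefines (hS : S.Nonempty) {P : (ℕ → M) → Prop} (h : IsBdd S P) :
    ∃ θ V p, (∀ i, V i ∈ S) ∧ FormulaDefines θ V p P := by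
  obtain ⟨A₀, hA₀⟩ := hS
  induction h with
  | eq h h' =>
    obtain ⟨τ, p, h⟩ := h.exists_termDefines
    obtain ⟨σ, q, h'⟩ := h'.exists_termDefines
    obtain ⟨τ, σ, r, h, h'⟩ := exists_termDefines₂ h h'
    exact ⟨.eq τ σ, fun _ => A₀, r, fun _ => hA₀, fun v => by
      simp only [BddFormula.Holds, h v, h' v]⟩
  | lt h h' =>
    obtain ⟨τ, p, h⟩ := h.exists_termDefines
    obtain ⟨σ, q, h'⟩ := h'.exists_termDefines
    obtain ⟨τ, σ, r, h, h'⟩ := exists_termDefines₂ h h'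
    exact ⟨.lt τ σ, fun _ => A₀, r, fun _ => hA₀, fun v => by
      simp only [BddFormula.Holds, h v, h' v]⟩
  | @mem t A h hA =>
    obtain ⟨τ, p, h⟩ := h.exists_termDefines
    exact ⟨.mem τ 0, fun _ => A, p, fun _ => hA, fun v => by simp only [BddFormula.Holds, h v]⟩
  | not _ h =>
    obtain ⟨θ, V, p, hV, h⟩ := h
    exact ⟨.neg θ, V, p, hV, fun v => by simp only [BddFormula.Holds, h v]⟩
  | and _ _ h h' =>
    obtain ⟨θ, V, p, hV, h⟩ := h
    obtain ⟨η, W, q, hW, h'⟩ := h'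
    obtain ⟨θ, η, U, r, hU, h, h'⟩ := exists_formulaDefines₂ hV hW h h'
    exact ⟨.and θ η, U, r, hU, fun v => by simp only [BddFormula.Holds, h v, h' v]⟩
  | or _ _ h h' =>
    obtain ⟨θ, V, p, hV, h⟩ := h
    obtain ⟨η, W, q, hW, h'⟩ := h'
    obtain ⟨θ, η, U, r, hU, h, h'⟩ := exists_formulaDefines₂ hV hW h h'
    exact ⟨.or θ η, U, r, hU, fun v => by simp only [BddFormula.Holds, h v, h' v]⟩
  | ball_push h _ h' =>
    obtain ⟨τ, p, h⟩ := h.exists_termDefines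
    obtain ⟨θ, V, q, hV, h'⟩ := h'
    obtain ⟨τ, θ, r, h, h'⟩ := exists_quantifierDefines h h'
    exact ⟨.ball τ θ, V, r, hV, fun v => by simp only [BddFormula.Holds, h v, h']⟩
  | bex_push h _ h' =>
    obtain ⟨τ, p, h⟩ := h.exists_termDefines
    obtain ⟨θ, V, q, hV, h'⟩ := h'
    obtain ⟨τ, θ, r, h, h'⟩ := exists_quantifierDefines h h'
    exact ⟨.bex τ θ, V, r, hV, fun v => by simp only [BddFormula.Holds, h v, h']⟩

theorem IsBdd.comp {P : (ℕ → M) → Prop} (h : IsBdd S P) :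
    ∀ {σ : (ℕ → M) → ℕ → M}, (∀ n, IsPoly fun v => σ v n) → IsBdd S fun v => P (σ v) := by
  have key : ∀ {σ : (ℕ → M) → ℕ → M}, (∀ n, IsPoly fun v => σ v n) → ∀ n, IsPoly fun v =>
      SOA.push (v 0) (σ fun n => v (n + 1)) n := fun hσ n =>
    IsPoly.push (.var 0) (fun n => (hσ n).tail) n
  induction h with
  | eq h h' => exact fun hσ => .eq (h.comp hσ) (h'.comp hσ)
  | lt h h' => exact fun hσ => .lt (h.comp hσ) (h'.comp hσ)
  | mem h hA => exact fun hσ => .mem (h.comp hσ) hA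
  | not _ h => exact fun hσ => .not (h hσ)
  | and _ _ h h' => exact fun hσ => .and (h hσ) (h' hσ)
  | or _ _ h h' => exact fun hσ => .or (h hσ) (h' hσ)
  | ball_push h _ h' => exact fun hσ => .ball_push (h.comp hσ) (h' (key hσ))
  | bex_push h _ h' => exact fun hσ => .bex_push (h.comp hσ) (h' (key hσ))

theorem IsBdd.congr {P R : (ℕ → M) → Prop} (h : IsBdd S P) (hPR : ∀ v, R v ↔ P v) : IsBdd S R := by
  rwa [show R = P from funext fun v => propext (hPR v)]

theorem IsBdd.imp {P R : (ℕ → M) → Prop} (h : IsBdd S P) (h' : IsBdd S R) :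
    IsBdd S fun v => P v → R v :=
  (h.not.or h').congr fun _ => imp_iff_not_or

theorem IsBdd.iff {P R : (ℕ → M) → Prop} (h : IsBdd S P) (h' : IsBdd S R) :
    IsBdd S fun v => P v ↔ R v :=
  ((h.imp h').and (h'.imp h)).congr fun _ => iff_iff_implies_and_implies

theorem IsBdd.le {s t : (ℕ → M) → M} (hs : IsPoly s) (ht : IsPoly t) :
    IsBdd S fun v => s v ≤ t v :=
  (IsBdd.lt ht hs).not.congr fun _ => not_lt.symm

/-- With the bound variable as an explicit argument of `P`, unification can read `P` off an ordinary
bounded quantifier. -/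
theorem IsBdd.ball {t : (ℕ → M) → M} {P : M → (ℕ → M) → Prop} (ht : IsPoly t)
    (h : IsBdd S fun w => P (w 0) fun n => w (n + 1)) :
    IsBdd S fun v => ∀ a, a < t v → P a v :=
  .ball_push ht h

theorem IsBdd.bex {t : (ℕ → M) → M} {P : M → (ℕ → M) → Prop} (ht : IsPoly t)
    (h : IsBdd S fun w => P (w 0) fun n => w (n + 1)) :
    IsBdd S fun v => ∃ a, a < t v ∧ P a v :=
  .bex_push ht h

end

/-! ### `Σ⁰₁` and `Δ⁰₁` predicates -/

section

variable {M : Type u} [CommSemiring M] [LinearOrder M] [IsStrictOrderedRing M] {S : Set (Set M)}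

theorem IsModelRCA0.canonicallyOrderedAdd (hM : IsModelRCA0 M S) : CanonicallyOrderedAdd M where
  exists_add_of_le {a b} h := by
    rcases h.lt_or_eq with h | rfl
    · obtain ⟨z, hz⟩ := hM.exists_add_of_lt a b h
      exact ⟨z, hz.symm⟩
    · exact ⟨0, (add_zero a).symm⟩
  le_add_self a b := le_add_of_nonneg_left (hM.zero_le b)
  le_self_add a b := le_add_of_nonneg_right (hM.zero_le b)

theorem IsModelRCA0.lt_add_one_iff (hM : IsModelRCA0 M S) {x y : M} : x < y + 1 ↔ x ≤ y := by
  rw [hM.lt_iff_add_one_le, add_le_add_iff_right]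

theorem IsModelRCA0.not_lt_zero (hM : IsModelRCA0 M S) {x : M} : ¬ x < 0 :=
  not_lt.2 (hM.zero_le x)

/-- Predicates of an assignment defined by `Σ⁰₁` formulas with parameters from `M` and `S`. -/
def IsSigma (S : Set (Set M)) (P : (ℕ → M) → Prop) : Prop :=
  ∃ R, IsBdd S R ∧ ∀ v, P v ↔ ∃ m, R (push m v)

/-- Predicates that are `Σ⁰₁` together with their negation. -/
structure IsDelta (S : Set (Set M)) (P : (ℕ → M) → Prop) : Prop where
  pos : IsSigma S P
  neg : IsSigma S fun v => ¬ P v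

theorem IsBdd.isSigma {P : (ℕ → M) → Prop} (h : IsBdd S P) : IsSigma S P :=
  ⟨fun v => P fun n => v (n + 1), h.comp fun n => .var (n + 1), fun _ => ⟨fun h => ⟨0, h⟩,
    fun ⟨_, h⟩ => h⟩⟩

theorem IsBdd.isDelta {P : (ℕ → M) → Prop} (h : IsBdd S P) : IsDelta S P :=
  ⟨h.isSigma, h.not.isSigma⟩

theorem IsSigma.congr {P R : (ℕ → M) → Prop} (h : IsSigma S P) (hPR : ∀ v, R v ↔ P v) :
    IsSigma S R := by
  rwa [show R = P from funext fun v => propext (hPR v)]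

theorem IsSigma.comp {P : (ℕ → M) → Prop} (h : IsSigma S P) {σ : (ℕ → M) → ℕ → M}
    (hσ : ∀ n, IsPoly fun v => σ v n) : IsSigma S fun v => P (σ v) := by
  obtain ⟨R, hR, h⟩ := h
  exact ⟨_, hR.comp (IsPoly.push (.var 0) fun n => (hσ n).tail), fun v => h (σ v)⟩

theorem IsDelta.comp {P : (ℕ → M) → Prop} (h : IsDelta S P) {σ : (ℕ → M) → ℕ → M}
    (hσ : ∀ n, IsPoly fun v => σ v n) : IsDelta S fun v => P (σ v) :=
  ⟨h.pos.comp hσ, h.neg.comp hσ⟩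

theorem push_mix_comp_quantRen₂ (a b : M) (v p : ℕ → M) :
    push a (push b (mix v p)) ∘ (liftRen quantRen ∘ quantRen) = mix (push a (push b v)) p := by
  rw [← Function.comp_assoc, push_comp_liftRen, push_mix_comp_quantRen, push_mix_comp_quantRen]

theorem IsBdd.exists_holds_push_push (hS : S.Nonempty) {P : (ℕ → M) → Prop} (h : IsBdd S P) :
    ∃ θ V p, (∀ i, V i ∈ S) ∧
      ∀ m n, P (push m (push n fun _ => 0)) ↔ BddFormula.Holds V θ (push m (push n p)) := by
  obtain ⟨θ, V, p, hV, h⟩ := h.exists_formulaDefines hS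
  refine ⟨θ.rename id (liftRen quantRen ∘ quantRen), V, mix (fun _ => 0) p, hV, fun m n => ?_⟩
  rw [BddFormula.holds_rename, push_mix_comp_quantRen₂]
  exact h _

/-- `Σ⁰₁` induction. -/
theorem IsModelRCA0.induction (hM : IsModelRCA0 M S) {P : M → Prop}
    (hP : IsSigma S fun v => P (v 0)) (h0 : P 0) (h1 : ∀ n, P n → P (n + 1)) (n : M) : P n := by
  obtain ⟨R, hR, h⟩ := hP
  obtain ⟨θ, V, p, hV, hθ⟩ := hR.exists_holds_push_push hM.sets_nonempty
  have key : ∀ n, P n ↔ SigmaHolds θ V p n := fun n =>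
    (h (push n fun _ => 0)).trans (exists_congr fun m => hθ m n)
  rw [key]
  rw [key] at h0
  exact hM.sigma_induction θ V p hV h0 (fun n => by simpa only [key] using h1 n) n

/-- `Δ⁰₁` comprehension. -/
theorem IsModelRCA0.comprehension (hM : IsModelRCA0 M S) {A : Set M}
    (hA : IsDelta S fun v => v 0 ∈ A) : A ∈ S := by
  obtain ⟨⟨R, hR, h⟩, ⟨R', hR', h'⟩⟩ := hA
  -- The complement of `A` is `∃ m, R'`, so `A` itself is `∀ m, ¬ R'`, the `Π⁰₁` form that
  -- comprehension asks for.
  have hR'' : IsBdd S fun v => ¬ R' v := hR'.not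
  obtain ⟨θ, V, p, hV, hθ⟩ := hR.exists_holds_push_push hM.sets_nonempty
  obtain ⟨η, W, q, hW, hη⟩ := hR''.exists_holds_push_push hM.sets_nonempty
  let V' := mix V W
  let p' := mix p q
  -- Both formulas must use one assignment. The parameters are interleaved, and the double lift
  -- leaves the witness and the argument in places 0 and 1.
  let e : ℕ → ℕ := liftRen (liftRen fun n => 2 * n)
  let f : ℕ → ℕ := liftRen (liftRen fun n => 2 * n + 1)
  have hV' : ∀ i, V' i ∈ S := fun i => by
    unfold V' mix
    split
    exacts [hV _, hW _]
  have key : ∀ n, n ∈ A ↔ SigmaHolds (θ.rename (fun n => 2 * n) e) V' p' n := fun n =>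
    (h (push n fun _ => 0)).trans (exists_congr fun m => by
      rw [BddFormula.holds_rename, push_comp_liftRen, push_comp_liftRen, mix_comp_two_mul,
        mix_comp_two_mul, hθ])
  have key' : ∀ n, n ∈ A ↔ PiHolds (η.rename (fun n => 2 * n + 1) f) V' p' n := fun n => by
    have h2 := not_congr (h' (push n fun _ => 0))
    rw [not_not] at h2
    refine h2.trans (not_exists.trans (forall_congr' fun m => ?_))
    rw [BddFormula.holds_rename, push_comp_liftRen, push_comp_liftRen, mix_comp_two_mul_add_one,
      mix_comp_two_mul_add_one, ← hη]
  have := hM.delta_comprehension _ _ V' p' hV' fun n => (key n).symm.trans (key' n)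
  rwa [show A = _ from Set.ext key]

/-- Two unbounded existential quantifiers contract to one: a single number bounds both witnesses. -/
theorem IsSigma.ex (hM : IsModelRCA0 M S) {P : M → (ℕ → M) → Prop}
    (h : IsSigma S fun w => P (w 0) fun n => w (n + 1)) : IsSigma S fun v => ∃ a, P a v := by
  obtain ⟨R, hR, h⟩ := h
  refine ⟨fun w => ∃ a, a < w 0 + 1 ∧ ∃ m, m < w 0 + 1 ∧ R (push m (push a fun n => w (n + 1))),
    .bex (.add (.var 0) (.const 1)) (.bex (.add (.var 1) (.const 1)) (hR.comp
      (IsPoly.push (.var 0) (IsPoly.push (.var 1) fun n => .var (n + 1 + 1 + 1))))), fun v => ?_⟩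
  have key : ∀ a, P a v ↔ ∃ m, R (push m (push a v)) := fun a => h (push a v)
  simp only [key]
  refine ⟨fun ⟨a, m, hR⟩ => ⟨max a m, a, ?_, m, ?_, hR⟩, fun ⟨_, a, _, m, _, hR⟩ => ⟨a, m, hR⟩⟩
  · exact hM.lt_add_one_iff.2 (le_max_left a m)
  · exact hM.lt_add_one_iff.2 (le_max_right a m)

theorem IsSigma.and (hM : IsModelRCA0 M S) {P R : (ℕ → M) → Prop} (h : IsSigma S P)
    (h' : IsSigma S R) : IsSigma S fun v => P v ∧ R v := by
  obtain ⟨P', hP, h⟩ := h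
  obtain ⟨R', hR, h'⟩ := h'
  refine IsSigma.congr (P := fun v => ∃ a, ∃ b, P' (push a v) ∧ R' (push b v)) ?_ fun v => ?_
  · exact .ex hM (.ex hM (IsBdd.isSigma (.and
      (hP.comp (IsPoly.push (.var 1) fun n => .var (n + 1 + 1)))
      (hR.comp (IsPoly.push (.var 0) fun n => .var (n + 1 + 1))))))
  · rw [h, h']
    exact ⟨fun ⟨⟨a, ha⟩, ⟨b, hb⟩⟩ => ⟨a, b, ha, hb⟩, fun ⟨a, b, ha, hb⟩ => ⟨⟨a, ha⟩, ⟨b, hb⟩⟩⟩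

theorem IsSigma.or {P R : (ℕ → M) → Prop} (h : IsSigma S P)
    (h' : IsSigma S R) : IsSigma S fun v => P v ∨ R v := by
  obtain ⟨P', hP, h⟩ := h
  obtain ⟨R', hR, h'⟩ := h'
  exact ⟨_, hP.or hR, fun v => by simp only [h, h', exists_or]⟩

/-- `Σ⁰₁` collection, in the form that bounded universal quantifiers preserve `Σ⁰₁`. -/
theorem IsSigma.ball (hM : IsModelRCA0 M S) {t : (ℕ → M) → M} {P : M → (ℕ → M) → Prop}
    (ht : IsPoly t) (h : IsSigma S fun w => P (w 0) fun n => w (n + 1)) :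
    IsSigma S fun v => ∀ a, a < t v → P a v := by
  obtain ⟨R, hR, h⟩ := h
  refine IsSigma.congr
    (P := fun v => ∃ b, ∀ a, a < t v → ∃ m, m < b ∧ R (push m (push a v))) ?_ fun v => ?_
  · exact .ex hM (IsBdd.isSigma (.ball ht.tail (.bex (.var 1)
      (hR.comp (IsPoly.push (.var 0) (IsPoly.push (.var 1) fun n => .var (n + 1 + 1 + 1)))))))
  have key : ∀ a, P a v ↔ ∃ m, R (push m (push a v)) := fun a => h (push a v)
  simp only [key]
  refine ⟨fun H => ?_, fun ⟨b, H⟩ a ha => (H a ha).imp fun m hm => hm.2⟩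
  -- A common bound on the witnesses is built by `Σ⁰₁` induction on `j`. The clause `a < t v` stays,
  -- because witnesses are only available there.
  have ind : ∀ j, ∃ b, ∀ a, a < j → a < t v → ∃ m, m < b ∧ R (push m (push a v)) := by
    refine hM.induction ?_ ⟨0, fun a ha => (hM.not_lt_zero ha).elim⟩ ?_
    · exact .ex hM (IsBdd.isSigma (.ball (.var 1) (.imp (.lt (.var 0) (.const _)) (.bex (.var 1)
        (hR.comp (IsPoly.push (.var 0) (IsPoly.push (.var 1) fun n => .const (v n))))))))
    · rintro j ⟨b, hb⟩
      by_cases hj : j < t v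
      · obtain ⟨m, hm⟩ := H j hj
        refine ⟨max b (m + 1), fun a ha hat => ?_⟩
        rcases (hM.lt_add_one_iff.1 ha).lt_or_eq with ha | rfl
        · obtain ⟨m', hm', h'⟩ := hb a ha hat
          exact ⟨m', lt_max_of_lt_left hm', h'⟩
        · exact ⟨m, lt_max_of_lt_right (lt_add_one m), hm⟩
      · refine ⟨b, fun a ha hat => ?_⟩
        rcases (hM.lt_add_one_iff.1 ha).lt_or_eq with ha | rfl
        exacts [hb a ha hat, (hj hat).elim]
  obtain ⟨b, hb⟩ := ind (t v)
  exact ⟨b, fun a ha => hb a ha ha⟩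

theorem IsSigma.bex (hM : IsModelRCA0 M S) {t : (ℕ → M) → M} {P : M → (ℕ → M) → Prop}
    (ht : IsPoly t) (h : IsSigma S fun w => P (w 0) fun n => w (n + 1)) :
    IsSigma S fun v => ∃ a, a < t v ∧ P a v :=
  .ex hM (.and hM (IsBdd.isSigma (.lt (.var 0) ht.tail)) h)

theorem IsDelta.and (hM : IsModelRCA0 M S) {P R : (ℕ → M) → Prop} (h : IsDelta S P)
    (h' : IsDelta S R) : IsDelta S fun v => P v ∧ R v :=
  ⟨h.pos.and hM h'.pos, (h.neg.or h'.neg).congr fun _ => not_and_or⟩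

theorem IsDelta.bex (hM : IsModelRCA0 M S) {t : (ℕ → M) → M} {P : M → (ℕ → M) → Prop}
    (ht : IsPoly t) (h : IsDelta S fun w => P (w 0) fun n => w (n + 1)) :
    IsDelta S fun v => ∃ a, a < t v ∧ P a v :=
  ⟨h.pos.bex hM ht, (IsSigma.ball hM (P := fun a v => ¬ P a v) ht h.neg).congr fun _ => by
    push Not; rfl⟩

/-- The least number principle. -/
theorem IsModelRCA0.exists_least (hM : IsModelRCA0 M S) {P : M → Prop}
    (hP : IsDelta S fun v => P (v 0)) {n : M} (hn : P n) : ∃ n, P n ∧ ∀ m, m < n → ¬ P m := by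
  by_contra H
  push Not at H
  have : ∀ n, ∀ m, m < n → ¬ P m := by
    refine hM.induction ?_ (fun m hm => (hM.not_lt_zero hm).elim) fun n hn m hm => ?_
    · exact .ball hM (.var 0) (hP.neg.comp (σ := fun w _ => w 0) fun _ => .var 0)
    · rcases (hM.lt_add_one_iff.1 hm).lt_or_eq with hm | rfl
      · exact hn m hm
      · intro h
        obtain ⟨m', hm', h'⟩ := H m h
        exact hn m' hm' h'
  exact this (n + 1) n (lt_add_one n) hn

end

/-! ### Pairs and codes of finite sets -/

section

variable {M : Type u} [CommSemiring M] [LinearOrder M] [IsStrictOrderedRing M]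
  [CanonicallyOrderedAdd M] {S : Set (Set M)}

theorem IsModelRCA0.one_le_iff (hM : IsModelRCA0 M S) {x : M} : 1 ≤ x ↔ x ≠ 0 := by
  rw [← pos_iff_ne_zero, hM.lt_iff_add_one_le, zero_add]

theorem IsModelRCA0.le_mul_self (hM : IsModelRCA0 M S) (x : M) : x ≤ x * x := by
  rcases eq_or_ne x 0 with rfl | h
  · simp
  · exact le_mul_of_one_le_left (hM.zero_le _) (hM.one_le_iff.2 h)

theorem left_le_pair (i j : M) : i ≤ pair i j := le_add_self

theorem IsModelRCA0.right_le_pair (hM : IsModelRCA0 M S) (i j : M) : j ≤ pair i j :=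
  (le_add_self.trans (hM.le_mul_self (i + j))).trans le_self_add

/-- With `s = i + j`, the code lies between `s²` and `s² + s < (s + 1)²`, so pairs with different
sums occupy disjoint blocks. -/
theorem IsModelRCA0.pair_lt_pair (hM : IsModelRCA0 M S) {i j k l : M} (h : i + j < k + l) :
    pair i j < pair k l := by
  rw [hM.lt_iff_add_one_le] at h
  calc pair i j ≤ (i + j) * (i + j) + (i + j) := by unfold pair; gcongr; exact le_self_add
    _ < (i + j) * (i + j) + (i + j) + (i + j + 1) := lt_add_of_pos_right _ (by
      exact lt_of_lt_of_le zero_lt_one le_add_self)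
    _ = (i + j + 1) * (i + j + 1) := by ring
    _ ≤ (k + l) * (k + l) := by gcongr
    _ ≤ pair k l := le_self_add

theorem IsModelRCA0.pair_inj (hM : IsModelRCA0 M S) {i j k l : M} :
    pair i j = pair k l ↔ i = k ∧ j = l := by
  refine ⟨fun h => ?_, by rintro ⟨rfl, rfl⟩; rfl⟩
  have hs : i + j = k + l := by
    rcases lt_trichotomy (i + j) (k + l) with h' | h' | h'
    · exact absurd h (hM.pair_lt_pair h').ne
    · exact h'
    · exact absurd h (hM.pair_lt_pair h').ne'
  unfold pair at h
  rw [hs] at h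
  have hi : i = k := add_left_cancel h
  subst hi
  exact ⟨rfl, add_left_cancel hs⟩

theorem IsModelRCA0.finMem_pair (hM : IsModelRCA0 M S) {i k m n : M} :
    FinMem i (pair k (pair m n)) ↔ i < k ∧ m * (i + 1) + 1 ∣ n := by
  constructor
  · rintro ⟨k', m', n', h, h'⟩
    obtain ⟨h₁, h⟩ := hM.pair_inj.1 h
    obtain ⟨h₂, h₃⟩ := hM.pair_inj.1 h
    rwa [h₁, h₂, h₃]
  · exact fun h => ⟨k, m, n, rfl, h⟩

/-- This makes every quantifier over the members of a coded finite set a bounded one. -/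
theorem FinMem.lt {i c : M} (h : FinMem i c) : i < c := by
  obtain ⟨k, m, n, rfl, h, -⟩ := h
  exact h.trans_le (left_le_pair _ _)

/-- `b` is invertible modulo `a`. -/
def IsUnitMod (b a : M) : Prop := ∃ v w, v * b = w * a + 1

theorem IsUnitMod.mul {b c a : M} (hb : IsUnitMod b a) (hc : IsUnitMod c a) :
    IsUnitMod (b * c) a := by
  obtain ⟨v, w, h⟩ := hb
  obtain ⟨v', w', h'⟩ := hc
  refine ⟨v * v', w * w' * a + w + w', ?_⟩
  rw [show v * v' * (b * c) = (v * b) * (v' * c) by ring, h, h']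
  ring

theorem IsUnitMod.of_mul_left {b c a : M} (h : IsUnitMod (b * c) a) : IsUnitMod b a := by
  obtain ⟨v, w, h⟩ := h
  exact ⟨v * c, w, by rw [← h]; ring⟩

theorem IsUnitMod.add_left {b a : M} (h : IsUnitMod b a) : IsUnitMod (a + b) a := by
  obtain ⟨v, w, h⟩ := h
  exact ⟨v, w + v, by rw [mul_add, h]; ring⟩

theorem IsModelRCA0.isUnitMod_symm (hM : IsModelRCA0 M S) {b a : M} (ha : a ≠ 0) (hb : b ≠ 0)
    (h : IsUnitMod b a) : IsUnitMod a b := by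
  obtain ⟨v, w, h⟩ := h
  -- Without subtraction, the Bézout coefficients are kept nonnegative by adding `a * b * (w + v)`
  -- to both sides: `x` is `b * (w + v) - w` and `y` is `a * (w + v) - v`.
  obtain ⟨x, hx⟩ : ∃ x, b * (w + v) = w + x :=
    exists_add_of_le (le_self_add.trans (le_mul_of_one_le_left (hM.zero_le _) (hM.one_le_iff.2 hb)))
  obtain ⟨y, hy⟩ : ∃ y, a * (w + v) = v + y :=
    exists_add_of_le (le_add_self.trans (le_mul_of_one_le_left (hM.zero_le _) (hM.one_le_iff.2 ha)))
  refine ⟨x, y, add_left_cancel (a := w * a) ?_⟩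
  calc w * a + x * a = (w + x) * a := by ring
    _ = a * (w + v) * b := by rw [← hx]; ring
    _ = v * b + y * b := by rw [hy]; ring
    _ = w * a + (y * b + 1) := by rw [h]; ring

/-- Otherwise two multiples of `a > 1` would differ by exactly 1. -/
theorem IsModelRCA0.not_dvd_of_isUnitMod (hM : IsModelRCA0 M S) {b a : M} (ha : 1 < a)
    (h : IsUnitMod b a) : ¬ a ∣ b := by
  rintro ⟨t, rfl⟩
  obtain ⟨v, w, h⟩ := h
  have h1 : a * w < a * (v * t) := by
    rw [show a * (v * t) = v * (a * t) by ring, h, mul_comm a w]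
    exact lt_add_one _
  have h2 : w < v * t := lt_of_mul_lt_mul_left h1 (hM.zero_le _)
  rw [hM.lt_iff_add_one_le] at h2
  have h3 : a * (w + 1) ≤ a * (v * t) := mul_le_mul_of_nonneg_left h2 (hM.zero_le _)
  rw [show a * (v * t) = v * (a * t) by ring, h, mul_add, mul_one, mul_comm a w] at h3
  exact absurd (le_of_add_le_add_left h3) (not_le.2 ha)

theorem isUnitMod_one (a : M) : IsUnitMod 1 a := ⟨1, 0, by simp⟩

/-- Coprimality of the β moduli. Two of them differ by `m * (d + 1)` with `d < k`. Modulo either one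
`m` is a unit, and `d + 1` is a unit because it divides `m`. -/
theorem IsModelRCA0.isUnitMod_beta (hM : IsModelRCA0 M S) {m k i j : M}
    (hm₀ : m ≠ 0) (hm : ∀ i, i < k → i + 1 ∣ m) (hi : i < k) (hj : j < k) (hij : i ≠ j) :
    IsUnitMod (m * (j + 1) + 1) (m * (i + 1) + 1) := by
  wlog h : i < j generalizing i j
  · have := this hj hi hij.symm (lt_of_le_of_ne (not_lt.1 h) hij.symm)
    exact hM.isUnitMod_symm (add_pos_of_nonneg_of_pos (hM.zero_le _) one_pos).ne'
      (add_pos_of_nonneg_of_pos (hM.zero_le _) one_pos).ne' this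
  obtain ⟨d, rfl⟩ := exists_add_of_le ((hM.lt_iff_add_one_le i j).1 h)
  have hu : IsUnitMod m (m * (i + 1) + 1) := by
    have hx : m * (i + 1) ≠ 0 :=
      mul_ne_zero hm₀ (add_pos_of_nonneg_of_pos (hM.zero_le _) one_pos).ne'
    obtain ⟨y, hy⟩ := exists_add_of_le (hM.one_le_iff.2 hx)
    -- Modulo `m * (i + 1) + 1` the number `m * (i + 1)` is `-1`, hence its own inverse.
    refine IsUnitMod.of_mul_left (c := i + 1) ⟨m * (i + 1), y, ?_⟩
    rw [hy]
    ring
  have hd : IsUnitMod (d + 1) (m * (i + 1) + 1) := by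
    obtain ⟨t, ht⟩ := hm d (lt_of_le_of_lt le_add_self hj)
    rw [ht] at hu ⊢
    exact hu.of_mul_left
  have := (hu.mul hd).add_left
  rwa [show m * (i + 1) + 1 + m * (d + 1) = m * (i + 1 + d + 1) + 1 by ring] at this

/-- Plays the role of the factorial of `k`, obtained by induction without first defining a factorial
function. -/
theorem IsModelRCA0.exists_common_multiple (hM : IsModelRCA0 M S) (k : M) :
    ∃ m, m ≠ 0 ∧ ∀ i, i < k → ∃ t, m = (i + 1) * t := by
  refine hM.induction (P := fun k => ∃ m, m ≠ 0 ∧ ∀ i, i < k → ∃ t, m = (i + 1) * t) ?_ ?_ ?_ k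
  · refine .ex hM (.and hM (IsBdd.isSigma ?_) (.ball hM (.var 1) (.ex hM (IsBdd.isSigma ?_))))
    all_goals apply_rules [IsBdd.not, IsBdd.eq, IsPoly.add, IsPoly.mul, IsPoly.const, IsPoly.var]
  · exact ⟨1, one_ne_zero, fun i hi => (hM.not_lt_zero hi).elim⟩
  · rintro k ⟨m, hm, h⟩
    refine ⟨m * (k + 1),
      mul_ne_zero hm (add_pos_of_nonneg_of_pos (hM.zero_le _) one_pos).ne', fun i hi => ?_⟩
    rcases (hM.lt_add_one_iff.1 hi).lt_or_eq with hi | rfl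
    · obtain ⟨t, rfl⟩ := h i hi
      exact ⟨t * (k + 1), by ring⟩
    · exact ⟨m, mul_comm _ _⟩

theorem IsBdd.isTriple (hM : IsModelRCA0 M S) {t : (ℕ → M) → M} (ht : IsPoly t) :
    IsBdd S fun v => IsTriple (t v) := by
  have : IsBdd S fun v => ∃ k, k < t v + 1 ∧ ∃ m, m < t v + 1 ∧ ∃ n, n < t v + 1 ∧
      t v = pair k (pair m n) := by
    apply_rules [IsBdd.bex, IsBdd.eq, IsPoly.pair, IsPoly.add, IsPoly.const, IsPoly.var,
      ht.tail, ht.tail.tail, ht.tail.tail.tail]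
  refine this.congr fun v => ⟨?_, ?_⟩
  · rintro ⟨k, m, n, h⟩
    simp only [hM.lt_add_one_iff]
    refine ⟨k, ?_, m, ?_, n, ?_, h⟩ <;> rw [h]
    · exact left_le_pair _ _
    · exact (left_le_pair _ _).trans (hM.right_le_pair _ _)
    · exact (hM.right_le_pair _ _).trans (hM.right_le_pair _ _)
  · rintro ⟨k, -, m, -, n, -, h⟩
    exact ⟨k, m, n, h⟩

theorem IsBdd.finMem (hM : IsModelRCA0 M S) {s t : (ℕ → M) → M} (hs : IsPoly s) (ht : IsPoly t) :
    IsBdd S fun v => FinMem (s v) (t v) := by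
  have : IsBdd S fun v => ∃ k, k < t v + 1 ∧ ∃ m, m < t v + 1 ∧ ∃ n, n < t v + 1 ∧
      t v = pair k (pair m n) ∧ s v < k ∧ ∃ q, q < n + 1 ∧ n = (m * (s v + 1) + 1) * q := by
    apply_rules [IsBdd.bex, IsBdd.eq, IsBdd.and, IsBdd.lt, IsPoly.pair, IsPoly.add, IsPoly.mul,
      IsPoly.const, IsPoly.var, ht.tail, ht.tail.tail, ht.tail.tail.tail, hs.tail.tail.tail,
      hs.tail.tail.tail.tail]
  refine this.congr fun v => ⟨?_, ?_⟩
  · rintro ⟨k, m, n, h, hk, q, hq⟩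
    simp only [hM.lt_add_one_iff]
    refine ⟨k, ?_, m, ?_, n, ?_, h, hk, q, ?_, hq⟩
    · rw [h]; exact left_le_pair _ _
    · rw [h]; exact (left_le_pair _ _).trans (hM.right_le_pair _ _)
    · rw [h]; exact (hM.right_le_pair _ _).trans (hM.right_le_pair _ _)
    · rw [hq]; exact le_mul_of_one_le_left (hM.zero_le _) le_add_self
  · rintro ⟨k, -, m, -, n, -, h, hk, q, -, hq⟩
    exact ⟨k, m, n, h, hk, q, hq⟩

/-- The codes `c` and `d` represent the same finite set. -/
theorem IsBdd.finEq (hM : IsModelRCA0 M S) {s t : (ℕ → M) → M} (hs : IsPoly s) (ht : IsPoly t) :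
    IsBdd S fun v => ∀ i, FinMem i (s v) ↔ FinMem i (t v) := by
  have : IsBdd S fun v => ∀ i, i < s v + t v → (FinMem i (s v) ↔ FinMem i (t v)) :=
    .ball (.add hs ht) (.iff (.finMem hM (.var 0) hs.tail) (.finMem hM (.var 0) ht.tail))
  refine this.congr fun v => ⟨fun h i _ => h i, fun h i => ?_⟩
  by_cases hi : i < s v + t v
  · exact h i hi
  · exact ⟨fun h => (hi (h.lt.trans_le le_self_add)).elim,
      fun h => (hi (h.lt.trans_le le_add_self)).elim⟩

theorem IsBdd.isFinCode (hM : IsModelRCA0 M S) {t : (ℕ → M) → M} (ht : IsPoly t) :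
    IsBdd S fun v => IsFinCode (t v) :=
  .and (.isTriple hM ht) (.ball ht (.imp (.isTriple hM (.var 0))
    (.not (.finEq hM (.var 0) ht.tail))))

theorem IsBdd.mem_Pfin (hM : IsModelRCA0 M S) {A : Set M} (hA : A ∈ S) {t : (ℕ → M) → M}
    (ht : IsPoly t) : IsBdd S fun v => t v ∈ Pfin A := by
  have : IsBdd S fun v => IsFinCode (t v) ∧ ∀ i, i < t v → FinMem i (t v) → i ∈ A :=
    .and (.isFinCode hM ht) (.ball ht (.imp (.finMem hM (.var 0) ht.tail) (.mem (.var 0) hA)))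
  exact this.congr fun v => and_congr_right fun _ =>
    ⟨fun h i _ => h i, fun h i hi => h i hi.lt hi⟩

theorem IsFinCode.ext {c d : M} (hc : IsFinCode c) (hd : IsFinCode d)
    (h : ∀ i, FinMem i c ↔ FinMem i d) : c = d := by
  rcases lt_trichotomy c d with h' | h' | h'
  · exact (hd.2 c h' hc.1 h).elim
  · exact h'
  · exact (hc.2 d h' hd.1 fun i => (h i).symm).elim

theorem IsModelRCA0.exists_isFinCode (hM : IsModelRCA0 M S) {c : M} (hc : IsTriple c) :
    ∃ d, IsFinCode d ∧ ∀ i, FinMem i d ↔ FinMem i c := by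
  obtain ⟨d, ⟨hd, h⟩, hmin⟩ := hM.exists_least
    (P := fun d => IsTriple d ∧ ∀ i, FinMem i d ↔ FinMem i c)
    (IsBdd.isDelta (.and (.isTriple hM (.var 0)) (.finEq hM (.var 0) (.const c))))
    ⟨hc, fun _ => Iff.rfl⟩
  exact ⟨d, ⟨hd, fun e he he' H => hmin e he ⟨he', fun i => (H i).trans (h i)⟩⟩, h⟩

/-- Every bounded part of a set has a code. -/
theorem IsModelRCA0.exists_code (hM : IsModelRCA0 M S) {A : Set M} (hA : A ∈ S) (k : M) :
    ∃ c, IsFinCode c ∧ ∀ i, FinMem i c ↔ i < k ∧ i ∈ A := by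
  obtain ⟨m, hm₀, hm⟩ := hM.exists_common_multiple k
  -- The intended `n` is the product of the moduli `m * (i + 1) + 1` over `i < j` in `A`. The second
  -- alternative says that `n` is a unit rather than a non-multiple, because units are closed under
  -- multiplication.
  have ind : ∀ j, ∃ n, ∀ i, i < k →
      ((∃ t, n = (m * (i + 1) + 1) * t) ∧ i < j ∧ i ∈ A) ∨
      ((∃ v, ∃ w, v * n = w * (m * (i + 1) + 1) + 1) ∧ ¬ (i < j ∧ i ∈ A)) := by
    refine hM.induction ?_ ?_ ?_
    · refine .ex hM (.ball hM (.const k) (.or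
        (.and hM (.ex hM (IsBdd.isSigma ?_)) (IsBdd.isSigma ?_))
        (.and hM (.ex hM (.ex hM (IsBdd.isSigma ?_))) (IsBdd.isSigma ?_))))
      all_goals apply_rules [IsBdd.not, IsBdd.and, IsBdd.eq, IsBdd.lt, IsBdd.mem, IsPoly.add,
        IsPoly.mul, IsPoly.const, IsPoly.var]
    · exact ⟨1, fun i _ => .inr ⟨isUnitMod_one _, fun h => hM.not_lt_zero h.1⟩⟩
    · rintro j ⟨n, hn⟩
      by_cases hj : j < k ∧ j ∈ A
      · refine ⟨n * (m * (j + 1) + 1), fun i hi => ?_⟩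
        rcases eq_or_ne i j with rfl | hij
        · exact .inl ⟨⟨n, mul_comm _ _⟩, lt_add_one i, hj.2⟩
        have hlt : i < j + 1 ↔ i < j := by
          rw [hM.lt_add_one_iff]
          exact ⟨fun h => lt_of_le_of_ne h hij, le_of_lt⟩
        rw [hlt]
        refine (hn i hi).imp ?_ ?_
        · rintro ⟨⟨t, rfl⟩, h⟩
          exact ⟨⟨t * (m * (j + 1) + 1), by ring⟩, h⟩
        · rintro ⟨hu, h⟩
          exact ⟨IsUnitMod.mul hu (hM.isUnitMod_beta hm₀ hm hi hj.1 hij), h⟩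
      · refine ⟨n, fun i hi => ?_⟩
        have hlt : (i < j + 1 ∧ i ∈ A) ↔ (i < j ∧ i ∈ A) := by
          rw [hM.lt_add_one_iff]
          refine ⟨fun h => ⟨lt_of_le_of_ne h.1 ?_, h.2⟩, fun h => ⟨h.1.le, h.2⟩⟩
          rintro rfl
          exact hj ⟨hi, h.2⟩
        rw [hlt]
        exact hn i hi
  obtain ⟨n, hn⟩ := ind k
  obtain ⟨c, hc, h⟩ := hM.exists_isFinCode (c := pair k (pair m n)) ⟨k, m, n, rfl⟩
  refine ⟨c, hc, fun i => (h i).trans (hM.finMem_pair.trans (and_congr_right fun hi => ?_))⟩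
  rcases hn i hi with ⟨h₁, h₂⟩ | ⟨h₁, h₂⟩
  · exact ⟨fun _ => h₂.2, fun _ => h₁⟩
  · have h1 : 1 < m * (i + 1) + 1 := lt_add_of_pos_left _
      (pos_iff_ne_zero.2 (mul_ne_zero hm₀ (add_pos_of_nonneg_of_pos (hM.zero_le _) one_pos).ne'))
    exact ⟨fun h => (hM.not_dvd_of_isUnitMod h1 h₁ h).elim, fun h => (h₂ ⟨hi, h⟩).elim⟩

end

/-! ### Functions, choice and iteration -/

section

variable {M : Type u} [CommSemiring M] [LinearOrder M] [IsStrictOrderedRing M]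
  [CanonicallyOrderedAdd M] {S : Set (Set M)}

/-- The graph of `g` as a set of coded pairs. -/
def graph (g : M → M) : Set M := {z | ∃ n, z = pair n (g n)}

theorem IsModelRCA0.pair_mem_graph (hM : IsModelRCA0 M S) {g : M → M} {n y : M} :
    pair n y ∈ graph g ↔ y = g n := by
  refine ⟨?_, fun h => ⟨n, by rw [h]⟩⟩
  rintro ⟨k, h⟩
  obtain ⟨rfl, h⟩ := hM.pair_inj.1 h
  exact h

theorem IsBdd.eq_app (hM : IsModelRCA0 M S) {g : M → M} (hg : graph g ∈ S)
    {s t : (ℕ → M) → M} (hs : IsPoly s) (ht : IsPoly t) : IsBdd S fun v => s v = g (t v) :=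
  (IsBdd.mem (ht.pair hs) hg).congr fun _ => hM.pair_mem_graph.symm

theorem IsSigma.app (hM : IsModelRCA0 M S) {g : M → M} (hg : graph g ∈ S)
    {P : M → (ℕ → M) → Prop} {t : (ℕ → M) → M} (ht : IsPoly t)
    (h : IsSigma S fun w => P (w 0) fun n => w (n + 1)) : IsSigma S fun v => P (g (t v)) v :=
  (IsSigma.ex hM (P := fun a v => a = g (t v) ∧ P a v)
    (.and hM (IsBdd.isSigma (.eq_app hM hg (.var 0) ht.tail)) h)).congr fun v =>
      ⟨fun h => ⟨_, rfl, h⟩, by rintro ⟨_, rfl, h⟩; exact h⟩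

/-- For a total function a `Σ⁰₁` graph is already `Δ⁰₁`: the value differs from `y` exactly when
some `y' ≠ y` is the value. -/
theorem IsModelRCA0.graph_mem (hM : IsModelRCA0 M S) {g : M → M}
    (hg : IsSigma S fun v => v 1 = g (v 0)) : graph g ∈ S := by
  have hg' : ∀ i j, IsSigma S fun v => v j = g (v i) := fun i j =>
    hg.comp (σ := fun v => push (v i) (push (v j) fun _ => 0))
      (IsPoly.push (.var i) (IsPoly.push (.var j) fun _ => .const 0))
  refine hM.comprehension ⟨?_, ?_⟩
  · refine IsSigma.congr (P := fun v => ∃ n, ∃ y, v 0 = pair n y ∧ y = g n) ?_ fun v => ?_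
    · exact .ex hM (.ex hM (.and hM (IsBdd.isSigma (.eq (.var 2) (.pair (.var 1) (.var 0))))
        (hg' 1 0)))
    · exact ⟨fun ⟨n, h⟩ => ⟨n, _, h, rfl⟩, fun ⟨n, y, h, h'⟩ => ⟨n, by rw [h, h']⟩⟩
  · refine IsSigma.congr (P := fun v => (∀ n, n < v 0 + 1 → ∀ y, y < v 0 + 1 → ¬ v 0 = pair n y) ∨
      ∃ n, ∃ y, ∃ y', (v 0 = pair n y ∧ ¬ y = y') ∧ y' = g n) ?_ fun v => ?_
    · refine .or (IsBdd.isSigma ?_)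
        (.ex hM (.ex hM (.ex hM (.and hM (IsBdd.isSigma ?_) (hg' 2 0)))))
      all_goals apply_rules [IsBdd.ball, IsBdd.and, IsBdd.not, IsBdd.eq, IsPoly.pair, IsPoly.add,
        IsPoly.const, IsPoly.var]
    · constructor
      · intro h
        by_cases H : ∃ n y, v 0 = pair n y
        · obtain ⟨n, y, hv⟩ := H
          exact .inr ⟨n, y, g n, ⟨hv, fun hy => h ⟨n, by rw [hv, hy]⟩⟩, rfl⟩
        · push Not at H
          exact .inl fun n _ y _ => H n y
      · rintro (h | ⟨n, y, y', ⟨h, hy⟩, rfl⟩)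
        · rintro ⟨n, hn⟩
          refine h n ?_ (g n) ?_ hn <;> rw [hM.lt_add_one_iff, hn]
          exacts [left_le_pair _ _, hM.right_le_pair _ _]
        · rw [h]
          exact fun h => hy (hM.pair_mem_graph.1 h)

/-- A total `Σ⁰₁` relation contains a function. -/
theorem IsModelRCA0.exists_choice (hM : IsModelRCA0 M S) {P : M → M → Prop}
    (hP : IsSigma S fun v => P (v 0) (v 1)) (h : ∀ n, ∃ y, P n y) :
    ∃ g : M → M, graph g ∈ S ∧ ∀ n, P n (g n) := by
  obtain ⟨R, hR, hPR⟩ := hP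
  -- Pairing a value with its `Σ⁰₁` witness makes the relation bounded. The least such pair is then
  -- definable, and its first component is the choice.
  let T : M → M → Prop := fun n z => ∃ y, y < z + 1 ∧ ∃ w, w < z + 1 ∧
    (z = pair y w ∧ R (push w (push n (push y fun _ => 0))))
  have hT : ∀ i j, IsBdd S fun v => T (v i) (v j) := fun i j =>
    .bex (.add (.var j) (.const 1)) (.bex (.add (.var (j + 1)) (.const 1)) (.and
      (.eq (.var (j + 2)) (.pair (.var 1) (.var 0)))
      (hR.comp (IsPoly.push (.var 0) (IsPoly.push (.var (i + 2))
        (IsPoly.push (.var 1) fun _ => .const 0))))))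
  have hTP : ∀ n y w, T n (pair y w) → P n y := by
    rintro n y w ⟨y', _, w', _, h, hR⟩
    obtain ⟨rfl, rfl⟩ := hM.pair_inj.1 h
    exact (hPR (push n (push y fun _ => 0))).2 ⟨w, hR⟩
  have hex : ∀ n, ∃ z, T n z := fun n => by
    obtain ⟨y, hy⟩ := h n
    obtain ⟨w, hw⟩ := (hPR (push n (push y fun _ => 0))).1 hy
    exact ⟨pair y w, y, hM.lt_add_one_iff.2 (left_le_pair _ _), w,
      hM.lt_add_one_iff.2 (hM.right_le_pair _ _), rfl, hw⟩
  have hmin : ∀ n, ∃ y w, T n (pair y w) ∧ ∀ z, z < pair y w → ¬ T n z := fun n => by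
    obtain ⟨z, hz⟩ := hex n
    obtain ⟨z, hz, hmin⟩ := hM.exists_least (P := T n) (IsBdd.isDelta
      ((hT 0 1).comp (IsPoly.push (.const n) fun _ => .var 0))) hz
    obtain ⟨y, _, w, _, rfl, _⟩ := id hz
    exact ⟨y, w, hz, hmin⟩
  choose g w hg hmin using hmin
  refine ⟨g, hM.graph_mem ?_, fun n => hTP n _ _ (hg n)⟩
  refine IsSigma.congr (P := fun v => ∃ w, ∃ u, u = pair (v 1) w ∧ (T (v 0) u ∧
    ∀ z, z < u → ¬ T (v 0) z)) ?_ fun v => ?_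
  · exact .ex hM (.ex hM (IsBdd.isSigma (.and (.eq (.var 0) (.pair (.var 3) (.var 1)))
      (.and (hT 2 0) (.ball (.var 0) (.not (hT 3 0)))))))
  · constructor
    · intro h
      exact ⟨w (v 0), _, rfl, by rw [h]; exact ⟨hg _, hmin _⟩⟩
    · rintro ⟨w', _, rfl, h, h'⟩
      rcases lt_trichotomy (pair (v 1) w') (pair (g (v 0)) (w (v 0))) with hlt | heq | hlt
      · exact (hmin _ _ hlt h).elim
      · exact (hM.pair_inj.1 heq).1
      · exact (h' _ hlt (hg _)).elim

/-- `c` codes a finite set of pairs each of which is either `(0, a)` or of the form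
`(i + 1, g y)` with `(i, y)` in the set. -/
def IsComputation (g : M → M) (a c : M) : Prop :=
  ∀ z, z < c → ¬ FinMem z c ∨ z = pair 0 a ∨
    ∃ i, ∃ y, FinMem (pair i y) c ∧ ∃ x, x = g y ∧ z = pair (i + 1) x

theorem IsSigma.isComputation (hM : IsModelRCA0 M S) {g : M → M} (hg : graph g ∈ S) (a : M)
    {t : (ℕ → M) → M} (ht : IsPoly t) : IsSigma S fun v => IsComputation g a (t v) := by
  refine .ball hM ht (.or (IsBdd.isSigma (.not (.finMem hM (.var 0) ht.tail))) (.or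
    (IsBdd.isSigma (.eq (.var 0) (.const _))) (.ex hM (.ex hM (.and hM
      (IsBdd.isSigma (.finMem hM (.pair (.var 1) (.var 0)) ht.tail.tail.tail)) (.ex hM
        (.and hM (IsBdd.isSigma (.eq_app hM hg (.var 0) (.var 1))) (IsBdd.isSigma
          (.eq (.var 3) (.pair (.add (.var 2) (.const 1)) (.var 0)))))))))))

theorem IsComputation.zero (hM : IsModelRCA0 M S) {g : M → M} {a c y : M}
    (hc : IsComputation g a c) (h : FinMem (pair 0 y) c) : y = a := by
  rcases hc _ h.lt with h' | h' | ⟨i, y', -, x, -, h'⟩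
  · exact (h' h).elim
  · exact (hM.pair_inj.1 h').2
  · exact absurd (hM.pair_inj.1 h').1 (add_pos_of_nonneg_of_pos (hM.zero_le _) one_pos).ne

theorem IsComputation.succ (hM : IsModelRCA0 M S) {g : M → M} {a c i y : M}
    (hc : IsComputation g a c) (h : FinMem (pair (i + 1) y) c) :
    ∃ x, FinMem (pair i x) c ∧ y = g x := by
  rcases hc _ h.lt with h' | h' | ⟨j, x, hx, _, rfl, h'⟩
  · exact (h' h).elim
  · exact absurd (hM.pair_inj.1 h').1 (add_pos_of_nonneg_of_pos (hM.zero_le _) one_pos).ne'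
  · obtain ⟨h₁, h₂⟩ := hM.pair_inj.1 h'
    rw [add_right_cancel h₁, h₂]
    exact ⟨x, hx, rfl⟩

theorem IsComputation.unique (hM : IsModelRCA0 M S) {g : M → M} {a c d n y z : M}
    (hc : IsComputation g a c) (hd : IsComputation g a d)
    (h : FinMem (pair n y) c) (h' : FinMem (pair n z) d) : y = z := by
  -- Bounding `y` and `z` by the codes keeps the induction formula bounded, and the function `g`
  -- does not occur in it.
  have key : ∀ n, ∀ y, y < c → ∀ z, z < d → FinMem (pair n y) c → FinMem (pair n z) d → y = z := by
    refine hM.induction (IsBdd.isSigma (.ball (.const c) (.ball (.const d) (.imp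
      (.finMem hM (.pair (.var 2) (.var 1)) (.const c)) (.imp
      (.finMem hM (.pair (.var 2) (.var 0)) (.const d)) (.eq (.var 1) (.var 0))))))) ?_ ?_
    · intro y _ z _ h h'
      rw [hc.zero hM h, hd.zero hM h']
    · intro n ih y _ z _ h h'
      obtain ⟨y, hy, rfl⟩ := hc.succ hM h
      obtain ⟨z, hz, rfl⟩ := hd.succ hM h'
      rw [ih y ((hM.right_le_pair _ _).trans_lt hy.lt) z
        ((hM.right_le_pair _ _).trans_lt hz.lt) hy hz]
  exact key n y ((hM.right_le_pair _ _).trans_lt h.lt) z ((hM.right_le_pair _ _).trans_lt h'.lt) h h'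

theorem IsModelRCA0.exists_insert (hM : IsModelRCA0 M S) (c e : M) :
    ∃ d, IsFinCode d ∧ ∀ i, FinMem i d ↔ i = e ∨ FinMem i c := by
  have hA : {i | i = e ∨ FinMem i c} ∈ S := hM.comprehension (IsBdd.isDelta
    (.or (.eq (.var 0) (.const e)) (.finMem hM (.var 0) (.const c))))
  obtain ⟨d, hd, h⟩ := hM.exists_code hA (e + c + 1)
  refine ⟨d, hd, fun i => (h i).trans ⟨fun h => h.2, fun h => ⟨?_, h⟩⟩⟩
  rw [hM.lt_add_one_iff]
  rcases h with rfl | h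
  exacts [le_self_add, h.lt.le.trans le_add_self]

/-- Primitive recursion without parameters. -/
theorem IsModelRCA0.exists_iterate (hM : IsModelRCA0 M S) {g : M → M} (hg : graph g ∈ S) (a : M) :
    ∃ f : M → M, graph f ∈ S ∧ f 0 = a ∧ ∀ n, f (n + 1) = g (f n) := by
  have step : ∀ {c n y}, IsComputation g a c → FinMem (pair n y) c →
      ∃ d, IsComputation g a d ∧ FinMem (pair (n + 1) (g y)) d := by
    intro c n y hc h
    obtain ⟨d, -, hd⟩ := hM.exists_insert c (pair (n + 1) (g y))
    refine ⟨d, fun z _ => ?_, (hd _).2 (.inl rfl)⟩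
    by_cases hz : FinMem z d
    · right
      rcases (hd z).1 hz with rfl | hz
      · exact .inr ⟨n, y, (hd _).2 (.inr h), _, rfl, rfl⟩
      · rcases hc z hz.lt with h' | h' | ⟨i, y, hy, h'⟩
        · exact (h' hz).elim
        · exact .inl h'
        · exact .inr ⟨i, y, (hd _).2 (.inr hy), h'⟩
    · exact .inl hz
  have hσ : IsSigma S fun v => ∃ c, IsComputation g a c ∧ FinMem (pair (v 0) (v 1)) c :=
    .ex hM (.and hM (.isComputation hM hg a (.var 0))
      (IsBdd.isSigma (.finMem hM (.pair (.var 1) (.var 2)) (.var 0))))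
  obtain ⟨f, hf, h⟩ := hM.exists_choice
    (P := fun n y => ∃ c, IsComputation g a c ∧ FinMem (pair n y) c) hσ (by
      refine hM.induction (.ex hM (hσ.comp (σ := fun v => push (v 1) (push (v 0) fun _ => 0))
        (IsPoly.push (.var 1) (IsPoly.push (.var 0) fun _ => .const 0)))) ?_ ?_
      · obtain ⟨d, -, hd⟩ := hM.exists_insert 0 (pair 0 a)
        refine ⟨a, d, fun z _ => ?_, (hd _).2 (.inl rfl)⟩
        by_cases hz : FinMem z d
        · exact .inr (.inl (((hd z).1 hz).resolve_right fun h => hM.not_lt_zero h.lt))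
        · exact .inl hz
      · rintro n ⟨y, c, hc, h⟩
        exact ⟨g y, step hc h⟩)
  refine ⟨f, hf, ?_, fun n => ?_⟩
  · obtain ⟨c, hc, h⟩ := h 0
    exact hc.zero hM h
  · obtain ⟨c, hc, h₁⟩ := h n
    obtain ⟨d, hd, h₂⟩ := step hc h₁
    obtain ⟨e, he, h₃⟩ := h (n + 1)
    exact he.unique hM hd h₃ h₂

end

/-! ### The Alexandroff and the upper topology -/

section

variable {M : Type u} [CommSemiring M] [LinearOrder M] [IsStrictOrderedRing M]
  [CanonicallyOrderedAdd M] {S : Set (Set M)}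

theorem IsBdd.ex_le (hM : IsModelRCA0 M S) {t : (ℕ → M) → M} {P : M → (ℕ → M) → Prop}
    (ht : IsPoly t) (h : IsBdd S fun w => P (w 0) fun n => w (n + 1))
    (hb : ∀ a v, P a v → a ≤ t v) : IsBdd S fun v => ∃ a, P a v :=
  (IsBdd.bex (.add ht (.const 1)) h).congr fun v => exists_congr fun a =>
    ⟨fun h => ⟨hM.lt_add_one_iff.2 (hb a v h), h⟩, fun h => h.2⟩

theorem IsBdd.ball_finMem (hM : IsModelRCA0 M S) {t : (ℕ → M) → M} {P : M → (ℕ → M) → Prop}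
    (ht : IsPoly t) (h : IsBdd S fun w => P (w 0) fun n => w (n + 1)) :
    IsBdd S fun v => ∀ a, FinMem a (t v) → P a v :=
  (IsBdd.ball (P := fun a v => FinMem a (t v) → P a v) ht
    (.imp (.finMem hM (.var 0) ht.tail) h)).congr fun _ =>
      ⟨fun h a _ => h a, fun h a ha => h a ha.lt ha⟩

theorem IsModelRCA0.pair_mem_prodSet (hM : IsModelRCA0 M S) {A B : Set M} {a b : M} :
    pair a b ∈ prodSet A B ↔ a ∈ A ∧ b ∈ B := by
  refine ⟨?_, fun h => ⟨a, h.1, b, h.2, rfl⟩⟩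
  rintro ⟨a', ha, b', hb, h⟩
  obtain ⟨rfl, rfl⟩ := hM.pair_inj.1 h
  exact ⟨ha, hb⟩

theorem IsModelRCA0.isFun_graph (hM : IsModelRCA0 M S) {B : Set M} {g : M → M}
    (hg : ∀ n, g n ∈ B) : IsFun Set.univ B (graph g) := by
  refine ⟨?_, fun a _ => ⟨g a, ⟨hg a, a, rfl⟩, fun b hb => hM.pair_mem_graph.1 hb.2⟩⟩
  rintro _ ⟨n, rfl⟩
  exact ⟨n, trivial, _, hg n, rfl⟩

theorem IsFun.exists_eq_graph {B f : Set M} (hf : IsFun Set.univ B f) :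
    ∃ g : M → M, f = graph g ∧ ∀ n, g n ∈ B := by
  choose g hg hu using fun n => hf.2 n trivial
  refine ⟨g, Set.ext fun z => ⟨fun hz => ?_, ?_⟩, fun n => (hg n).1⟩
  · obtain ⟨n, -, b, hb, rfl⟩ := hf.1 hz
    exact ⟨n, by rw [hu n b ⟨hb, hz⟩]⟩
  · rintro ⟨n, rfl⟩
    exact (hg n).2

theorem IsModelRCA0.isOpenCode_graph (hM : IsModelRCA0 M S) {D : CSC M} {H : M → M}
    (hS : graph H ∈ S) (hH : ∀ n, H n ∈ Pfin D.I) : D.IsOpenCode S (graph H) :=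
  ⟨hS, hM.isFun_graph hH⟩

theorem IsModelRCA0.memAt_graph (hM : IsModelRCA0 M S) {D : CSC M} {H : M → M} {x n : M} :
    D.MemAt (graph H) x n ↔ ∃ i, FinMem i (H n) ∧ pair x i ∈ D.U := by
  simp only [CSC.MemAt, hM.pair_mem_graph]
  exact ⟨fun ⟨_, i, h, h'⟩ => ⟨i, h ▸ h'⟩, fun ⟨i, h⟩ => ⟨_, i, rfl, h⟩⟩

/-- A single stage involves only finitely many indices, so membership there is decidable, whereas
membership in the whole open set is only `Σ⁰₁`. -/
theorem IsDelta.memAt (hM : IsModelRCA0 M S) {D : CSC M} (hU : D.U ∈ S) {H : M → M}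
    (hH : graph H ∈ S) {s t : (ℕ → M) → M} (hs : IsPoly s) (ht : IsPoly t) :
    IsDelta S fun v => D.MemAt (graph H) (s v) (t v) := by
  have h : IsBdd S fun v => ∃ i, i < v 0 ∧ FinMem i (v 0) ∧ pair (v 1) i ∈ D.U :=
    .bex (.var 0) (.and (.finMem hM (.var 0) (.var 1)) (.mem (.pair (.var 2) (.var 0)) hU))
  have h' := h.comp (σ := fun v => push (v 0) (push (s fun n => v (n + 1)) fun _ => 0))
    (IsPoly.push (.var 0) (IsPoly.push hs.tail fun _ => .const 0))
  have key : ∀ v : ℕ → M, D.MemAt (graph H) (s v) (t v) ↔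
      ∃ i, i < H (t v) ∧ FinMem i (H (t v)) ∧ pair (s v) i ∈ D.U := fun v =>
    hM.memAt_graph.trans (exists_congr fun i => ⟨fun h => ⟨h.1.lt, h⟩, fun h => h.2⟩)
  refine ⟨IsSigma.congr (IsSigma.app hM hH (P := fun a v => ∃ i, i < a ∧ FinMem i a ∧
    pair (s v) i ∈ D.U) ht h'.isSigma) key, IsSigma.congr (IsSigma.app hM hH (P := fun a v =>
    ¬ ∃ i, i < a ∧ FinMem i a ∧ pair (s v) i ∈ D.U) ht h'.not.isSigma) fun v => not_congr (key v)⟩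

/-- A `Δ⁰₁` relation with finite sections is given by a sequence of codes of finite sets. -/
theorem IsModelRCA0.exists_sections (hM : IsModelRCA0 M S) {A : Set M} (hA : A ∈ S)
    {R : M → M → Prop} (hR : IsDelta S fun v => R (v 0) (v 1))
    (hb : ∀ n q, R n q → q ∈ A ∧ q ≤ n) :
    ∃ H : M → M, graph H ∈ S ∧ (∀ n, H n ∈ Pfin A) ∧ ∀ n q, FinMem q (H n) ↔ R n q := by
  have hR' : ∀ i j, IsDelta S fun v => R (v i) (v j) := fun i j =>
    hR.comp (σ := fun v => push (v i) (push (v j) fun _ => 0))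
      (IsPoly.push (.var i) (IsPoly.push (.var j) fun _ => .const 0))
  have hF : ∀ i j, IsDelta S fun v => FinMem (v i) (v j) := fun i j =>
    IsBdd.isDelta (.finMem hM (.var i) (.var j))
  -- Below `n + c + 1` lie all members of `c` and all `q ≤ n`, so agreement there is full agreement.
  -- Spelling out the two cases shows that it is `Σ⁰₁`.
  obtain ⟨H, hH, h⟩ := hM.exists_choice (P := fun n c => c ∈ Pfin A ∧ ∀ q, q < n + c + 1 →
      (FinMem q c ∧ R n q ∨ ¬ FinMem q c ∧ ¬ R n q))
    (.and hM (IsBdd.isSigma (.mem_Pfin hM hA (.var 1)))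
      (.ball hM (.add (.add (.var 0) (.var 1)) (.const 1))
        (.or (.and hM (hF 0 2).pos (hR' 1 0).pos) (.and hM (hF 0 2).neg (hR' 1 0).neg)))) (by
      intro n
      have hn : {q | R n q} ∈ S := hM.comprehension (hR.comp
        (σ := fun v => push n (push (v 0) fun _ => 0))
        (IsPoly.push (.const n) (IsPoly.push (.var 0) fun _ => .const 0)))
      obtain ⟨c, hc, h⟩ := hM.exists_code hn (n + 1)
      have h' : ∀ q, FinMem q c ↔ R n q := fun q => (h q).trans
        ⟨fun h => h.2, fun h => ⟨hM.lt_add_one_iff.2 (hb n q h).2, h⟩⟩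
      refine ⟨c, ⟨hc, fun q hq => (hb n q ((h' q).1 hq)).1⟩, fun q _ => ?_⟩
      rw [h' q]
      by_cases hq : R n q
      exacts [.inl ⟨hq, hq⟩, .inr ⟨hq, hq⟩])
  refine ⟨H, hH, fun n => (h n).1, fun n q => ?_⟩
  by_cases hq : q < n + H n + 1
  · rcases (h n).2 q hq with h | h
    exacts [iff_of_true h.1 h.2, iff_of_false h.1 h.2]
  · rw [hM.lt_add_one_iff] at hq
    exact iff_of_false (fun h => hq (h.lt.le.trans le_add_self))
      fun h => hq ((hb n q h).2.trans le_self_add)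

theorem IsModelRCA0.zero_mem_Pfin (hM : IsModelRCA0 M S) (A : Set M) : (0 : M) ∈ Pfin A :=
  ⟨⟨⟨0, 0, 0, by simp [pair]⟩, fun _ h => (hM.not_lt_zero h).elim⟩,
    fun _ h => (hM.not_lt_zero h.lt).elim⟩

theorem IsModelRCA0.exists_union (hM : IsModelRCA0 M S) {A : Set M} {c d : M}
    (hc : c ∈ Pfin A) (hd : d ∈ Pfin A) :
    ∃ e ∈ Pfin A, ∀ i, FinMem i e ↔ FinMem i c ∨ FinMem i d := by
  have h : {i | FinMem i c ∨ FinMem i d} ∈ S := hM.comprehension (IsBdd.isDelta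
    (.or (.finMem hM (.var 0) (.const c)) (.finMem hM (.var 0) (.const d))))
  obtain ⟨e, he, h⟩ := hM.exists_code h (c + d)
  have h' : ∀ i, FinMem i e ↔ FinMem i c ∨ FinMem i d := fun i => (h i).trans
    ⟨fun h => h.2, fun h => ⟨h.elim (fun h => h.lt.trans_le le_self_add)
      fun h => h.lt.trans_le le_add_self, h⟩⟩
  exact ⟨e, ⟨he, fun i hi => ((h' i).1 hi).elim (hc.2 i) (hd.2 i)⟩, h'⟩

variable {Q L : Set M}

theorem IsModelRCA0.pair_mem_alex_U (hM : IsModelRCA0 M S) (hQ : IsQuasiOrder S Q L) {x q : M} :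
    pair x q ∈ (alex Q L).U ↔ pair q x ∈ L := by
  refine ⟨?_, fun h => ?_⟩
  · rintro ⟨x', -, q', -, h, h'⟩
    obtain ⟨rfl, rfl⟩ := hM.pair_inj.1 h
    exact h'
  · obtain ⟨hq, hx⟩ := hM.pair_mem_prodSet.1 (hQ.rel_subset h)
    exact ⟨x, hx, q, hq, rfl, h⟩

theorem IsModelRCA0.pair_mem_upper_U (hM : IsModelRCA0 M S) {x c : M} :
    pair x c ∈ (upper Q L).U ↔ x ∈ Q ∧ c ∈ Pfin Q ∧ ∀ p, FinMem p c → pair x p ∉ L := by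
  refine ⟨?_, fun ⟨hx, hc, h⟩ => ⟨x, hx, c, hc, rfl, h⟩⟩
  rintro ⟨x', hx, c', hc, h, h'⟩
  obtain ⟨rfl, rfl⟩ := hM.pair_inj.1 h
  exact ⟨hx, hc, h'⟩

theorem IsModelRCA0.alex_isSpace (hM : IsModelRCA0 M S) (hQ : IsQuasiOrder S Q L) :
    (alex Q L).IsSpace S where
  X_mem := hQ.carrier_mem
  I_mem := hQ.carrier_mem
  U_mem := hM.comprehension <| IsBdd.isDelta <| by
    refine .ex_le hM (.var 0) (.and (.mem (.var 0) hQ.carrier_mem)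
      (.ex_le hM (.var 1) (.and (.mem (.var 0) hQ.carrier_mem)
        (.and (.eq (.var 2) (.pair (.var 1) (.var 0)))
          (.mem (.pair (.var 0) (.var 1)) hQ.rel_mem))) ?_)) ?_
    · rintro q v ⟨-, h, -⟩
      exact (hM.right_le_pair _ _).trans h.ge
    · rintro x v ⟨-, q, -, h, -⟩
      exact (left_le_pair _ _).trans h.ge
  k_mem := hM.comprehension <| IsBdd.isDelta <| by
    refine .ex_le hM (.var 0) (.and (.mem (.var 0) hQ.carrier_mem)
      (.ex_le hM (.var 1) (.and (.mem (.var 0) hQ.carrier_mem)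
        (.ex_le hM (.var 2) (.and (.mem (.var 0) hQ.carrier_mem)
        (.eq (.var 3) (.pair (.pair (.var 2) (.pair (.var 1) (.var 0))) (.var 2)))) ?_)) ?_)) ?_
    · rintro r v ⟨-, h⟩
      exact ((hM.right_le_pair _ _).trans ((hM.right_le_pair _ _).trans (left_le_pair _ _))).trans
        h.ge
    · rintro p v ⟨-, r, -, h⟩
      exact ((left_le_pair _ _).trans ((hM.right_le_pair _ _).trans (left_le_pair _ _))).trans h.ge
    · rintro q v ⟨-, p, -, r, -, h⟩
      exact (hM.right_le_pair _ _).trans h.ge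
  U_subset := by
    rintro _ ⟨x, hx, q, hq, rfl, -⟩
    exact ⟨x, hx, q, hq, rfl⟩
  k_fun := by
    constructor
    · rintro _ ⟨q, hq, p, hp, r, hr, rfl⟩
      exact ⟨_, ⟨q, hq, _, ⟨p, hp, r, hr, rfl⟩, rfl⟩, q, hq, rfl⟩
    · rintro _ ⟨q, hq, _, ⟨p, hp, r, hr, rfl⟩, rfl⟩
      refine ⟨q, ⟨hq, q, hq, p, hp, r, hr, rfl⟩, ?_⟩
      rintro l ⟨-, q', -, p', -, r', -, h⟩
      obtain ⟨h₁, rfl⟩ := hM.pair_inj.1 h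
      exact (hM.pair_inj.1 h₁).1.symm
  cover x hx := ⟨x, hx, (hM.pair_mem_alex_U hQ).2 (hQ.refl x hx)⟩
  inter := by
    rintro x hx i hi j hj l - hxi hxj ⟨q, -, p, -, r, -, h⟩
    obtain ⟨h₁, rfl⟩ := hM.pair_inj.1 h
    obtain ⟨rfl, -⟩ := hM.pair_inj.1 h₁
    simp only [hM.pair_mem_alex_U hQ] at hxi hxj ⊢
    refine ⟨hQ.refl x hx, fun y hy => ?_⟩
    have hy' := (hM.pair_mem_prodSet.1 (hQ.rel_subset hy)).2
    exact ⟨hQ.trans i hi x hx y hy' hxi hy, hQ.trans j hj x hx y hy' hxj hy⟩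

theorem IsModelRCA0.upper_isSpace (hM : IsModelRCA0 M S) (hQ : IsQuasiOrder S Q L) :
    (upper Q L).IsSpace S where
  X_mem := hQ.carrier_mem
  I_mem := hM.comprehension <| IsBdd.isDelta <| .mem_Pfin hM hQ.carrier_mem (.var 0)
  U_mem := hM.comprehension <| IsBdd.isDelta <| by
    refine .ex_le hM (.var 0) (.and (.mem (.var 0) hQ.carrier_mem)
      (.ex_le hM (.var 1) (.and (.mem_Pfin hM hQ.carrier_mem (.var 0))
        (.and (.eq (.var 2) (.pair (.var 1) (.var 0))) (.ball_finMem hM (.var 0)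
          (.not (.mem (.pair (.var 2) (.var 0)) hQ.rel_mem))))) ?_)) ?_
    · rintro q v ⟨-, h, -⟩
      exact (hM.right_le_pair _ _).trans h.ge
    · rintro x v ⟨-, q, -, h, -⟩
      exact (left_le_pair _ _).trans h.ge
  k_mem := hM.comprehension <| IsBdd.isDelta <| by
    have hU : IsBdd S fun v : ℕ → M => ∀ i, FinMem i (v 0) ↔ FinMem i (v 2) ∨ FinMem i (v 1) := by
      refine IsBdd.congr (P := fun v => (∀ i, FinMem i (v 0) → FinMem i (v 2) ∨ FinMem i (v 1)) ∧
        (∀ i, FinMem i (v 2) → FinMem i (v 0)) ∧ ∀ i, FinMem i (v 1) → FinMem i (v 0)) ?_ fun v =>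
        ⟨fun h => ⟨fun i => (h i).1, fun i hi => (h i).2 (.inl hi), fun i hi => (h i).2 (.inr hi)⟩,
          fun h i => ⟨h.1 i, fun hi => hi.elim (h.2.1 i) (h.2.2 i)⟩⟩
      exact .and (.ball_finMem hM (.var 0) (.or (.finMem hM (.var 0) (.var 3))
          (.finMem hM (.var 0) (.var 2))))
        (.and (.ball_finMem hM (.var 2) (.finMem hM (.var 0) (.var 1)))
          (.ball_finMem hM (.var 1) (.finMem hM (.var 0) (.var 1))))
    refine .ex_le hM (.var 0) (.and (.mem (.var 0) hQ.carrier_mem)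
      (.ex_le hM (.var 1) (.and (.mem_Pfin hM hQ.carrier_mem (.var 0))
        (.ex_le hM (.var 2) (.and (.mem_Pfin hM hQ.carrier_mem (.var 0))
          (.ex_le hM (.var 3) (.and (.mem_Pfin hM hQ.carrier_mem (.var 0))
            (.and (.eq (.var 4) (.pair (.pair (.var 3) (.pair (.var 2) (.var 1))) (.var 0)))
              hU)) ?_)) ?_)) ?_)) ?_
    · rintro e v ⟨-, h, -⟩
      exact (hM.right_le_pair _ _).trans h.ge
    · rintro d v ⟨-, e, -, h, -⟩
      exact ((hM.right_le_pair _ _).trans ((hM.right_le_pair _ _).trans (left_le_pair _ _))).trans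
        h.ge
    · rintro c v ⟨-, d, -, e, -, h, -⟩
      exact ((left_le_pair _ _).trans ((hM.right_le_pair _ _).trans (left_le_pair _ _))).trans h.ge
    · rintro q v ⟨-, c, -, d, -, e, -, h, -⟩
      exact ((left_le_pair _ _).trans (left_le_pair _ _)).trans h.ge
  U_subset := by
    rintro _ ⟨x, hx, c, hc, rfl, -⟩
    exact ⟨x, hx, c, hc, rfl⟩
  k_fun := by
    constructor
    · rintro _ ⟨q, hq, c, hc, d, hd, e, he, rfl, -⟩
      exact ⟨_, ⟨q, hq, _, ⟨c, hc, d, hd, rfl⟩, rfl⟩, e, he, rfl⟩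
    · rintro _ ⟨q, hq, _, ⟨c, hc, d, hd, rfl⟩, rfl⟩
      obtain ⟨e, he, h⟩ := hM.exists_union hc hd
      refine ⟨e, ⟨he, q, hq, c, hc, d, hd, e, he, rfl, h⟩, ?_⟩
      rintro l ⟨-, q', -, c', -, d', -, e', he', heq, h'⟩
      obtain ⟨h₁, rfl⟩ := hM.pair_inj.1 heq
      obtain ⟨rfl, h₂⟩ := hM.pair_inj.1 h₁
      obtain ⟨rfl, rfl⟩ := hM.pair_inj.1 h₂
      exact he'.1.ext he.1 fun i => (h' i).trans (h i).symm
  -- The code 0 is that of the empty set, whose basic open set is all of `Q`.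
  cover x hx := ⟨0, hM.zero_mem_Pfin Q, hM.pair_mem_upper_U.2
    ⟨hx, hM.zero_mem_Pfin Q, fun _ h => (hM.not_lt_zero h.lt).elim⟩⟩
  inter := by
    rintro x hx c hc d hd e he hxc hxd ⟨q', -, c', -, d', -, e', -, heq, h⟩
    obtain ⟨h₁, rfl⟩ := hM.pair_inj.1 heq
    obtain ⟨rfl, h₂⟩ := hM.pair_inj.1 h₁
    obtain ⟨rfl, rfl⟩ := hM.pair_inj.1 h₂
    simp only [hM.pair_mem_upper_U] at hxc hxd ⊢
    exact ⟨⟨hx, he, fun p hp => ((h p).1 hp).elim (hxc.2.2 p) (hxd.2.2 p)⟩, fun y hy =>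
      ⟨⟨hy.1, hc, fun p hp => hy.2.2 p ((h p).2 (.inl hp))⟩,
        hy.1, hd, fun p hp => hy.2.2 p ((h p).2 (.inr hp))⟩⟩

end

/-! ### Noetherian spaces of quasi-orders -/

section

variable {M : Type u} [CommSemiring M] [LinearOrder M] [IsStrictOrderedRing M]
  [CanonicallyOrderedAdd M] {S : Set (Set M)} {Q L : Set M}

/-- Every effectively open set of the upper topology is effectively open in the Alexandroff
topology, uniformly in the stage of the enumeration. -/
theorem IsModelRCA0.exists_alex_code (hM : IsModelRCA0 M S) (hQ : IsQuasiOrder S Q L) {h : Set M}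
    (hh : (upper Q L).IsOpenCode S h) :
    ∃ h', (alex Q L).IsOpenCode S h' ∧
      (∀ x n, (alex Q L).MemAt h' x n → ∃ m, m ≤ n ∧ (upper Q L).MemAt h x m) ∧
      ∀ x, (upper Q L).MemOpen h x → (alex Q L).MemOpen h' x := by
  obtain ⟨hS, hf⟩ := hh
  obtain ⟨G, rfl, -⟩ := hf.exists_eq_graph
  have hsub : ∀ {x m}, (upper Q L).MemAt (graph G) x m → x ∈ Q := by
    rintro x m ⟨_, i, -, -, hU⟩
    exact (hM.pair_mem_upper_U.1 hU).1
  obtain ⟨H, hH, hHQ, hR⟩ := hM.exists_sections hQ.carrier_mem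
    (R := fun n q => ∃ m, m < n + 1 ∧ n = pair q m ∧ (upper Q L).MemAt (graph G) q m)
    (.bex hM (.add (.var 0) (.const 1)) (.and hM
      (IsBdd.isDelta (.eq (.var 1) (.pair (.var 2) (.var 0))))
      (.memAt hM (hM.upper_isSpace hQ).U_mem hS (.var 2) (.var 0)))) (by
    rintro n q ⟨m, -, rfl, hq⟩
    exact ⟨hsub hq, left_le_pair _ _⟩)
  refine ⟨graph H, hM.isOpenCode_graph hH hHQ, fun x n hx => ?_, fun x ⟨m, hx⟩ => ?_⟩
  · obtain ⟨q, hq, hqx⟩ := hM.memAt_graph.1 hx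
    obtain ⟨m, -, rfl, hm⟩ := (hR n q).1 hq
    refine ⟨m, hM.right_le_pair _ _, ?_⟩
    rw [hM.pair_mem_alex_U hQ] at hqx
    obtain ⟨hq, hx⟩ := hM.pair_mem_prodSet.1 (hQ.rel_subset hqx)
    obtain ⟨c, hc, hqc⟩ := hM.memAt_graph.1 hm
    obtain ⟨-, hcQ, hqc⟩ := hM.pair_mem_upper_U.1 hqc
    -- Upward closure of `V_c`: from `q ≤ x` and `x ≤ p` would follow `q ≤ p`.
    exact hM.memAt_graph.2 ⟨c, hc, hM.pair_mem_upper_U.2 ⟨hx, hcQ, fun p hp hxp =>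
      hqc p hp (hQ.trans q hq x hx p (hcQ.2 p hp) hqx hxp)⟩⟩
  · refine ⟨pair x m, hM.memAt_graph.2 ⟨x, (hR _ x).2 ⟨m, ?_, rfl, hx⟩, ?_⟩⟩
    · exact hM.lt_add_one_iff.2 (hM.right_le_pair _ _)
    · exact (hM.pair_mem_alex_U hQ).2 (hQ.refl x (hsub hx))

theorem IsModelRCA0.upper_isNoetherian (hM : IsModelRCA0 M S) (hQ : IsQuasiOrder S Q L)
    (hN : (alex Q L).IsNoetherian S) : (upper Q L).IsNoetherian S := by
  refine ⟨hM.upper_isSpace hQ, fun h hh f hf hsub => ?_⟩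
  obtain ⟨h', hh', h₁, h₂⟩ := hM.exists_alex_code hQ hh
  obtain ⟨f', hf', f₁, f₂⟩ := hM.exists_alex_code hQ hf
  have h₃ : ∀ x, (alex Q L).MemOpen h' x → (upper Q L).MemOpen h x := fun x ⟨n, hn⟩ =>
    (h₁ x n hn).imp fun _ h => h.2
  obtain ⟨N, hN⟩ := hN.2 h' hh' f' hf' fun x hx => f₂ x (hsub x (h₃ x hx))
  refine ⟨N, fun x hx => ?_⟩
  obtain ⟨n, hn, hxn⟩ := hN x (h₂ x hx)
  obtain ⟨m, hm, hxm⟩ := f₁ x n hxn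
  exact ⟨m, hm.trans_lt hn, hxm⟩

theorem IsModelRCA0.isWQO_of_alex (hM : IsModelRCA0 M S) (hQ : IsQuasiOrder S Q L)
    (hN : (alex Q L).IsNoetherian S) : IsWQO S Q L := by
  refine ⟨hQ, fun f hf hfun => ?_⟩
  obtain ⟨g, rfl, hg⟩ := hfun.exists_eq_graph
  -- The value `g m` is listed at stage `pair m (g m)`, not `m`, because `exists_sections` needs the
  -- members of a section bounded by its index.
  obtain ⟨H, hH, hHQ, hR⟩ := hM.exists_sections hQ.carrier_mem
    (R := fun n q => ∃ m, m < n + 1 ∧ n = pair m q ∧ q = g m)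
    (IsBdd.isDelta (.bex (.add (.var 0) (.const 1)) (.and
      (.eq (.var 1) (.pair (.var 0) (.var 2))) (.eq_app hM hf (.var 2) (.var 0))))) (by
    rintro n q ⟨m, -, rfl, rfl⟩
    exact ⟨hg m, hM.right_le_pair _ _⟩)
  have hcode := hM.isOpenCode_graph (D := alex Q L) hH hHQ
  obtain ⟨N, hN⟩ := hN.2 _ hcode _ hcode fun _ h => h
  obtain ⟨n, hn, hx⟩ := hN (g N) ⟨pair N (g N), hM.memAt_graph.2 ⟨g N,
    (hR _ _).2 ⟨N, hM.lt_add_one_iff.2 (left_le_pair _ _), rfl, rfl⟩,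
    (hM.pair_mem_alex_U hQ).2 (hQ.refl _ (hg N))⟩⟩
  obtain ⟨q, hq, hqx⟩ := hM.memAt_graph.1 hx
  obtain ⟨m, -, rfl, rfl⟩ := (hR n q).1 hq
  exact ⟨m, N, g m, g N, (left_le_pair _ _).trans_lt hn, ⟨m, rfl⟩, ⟨N, rfl⟩,
    (hM.pair_mem_alex_U hQ).1 hqx⟩

theorem IsModelRCA0.alex_isNoetherian (hM : IsModelRCA0 M S) (hW : IsWQO S Q L) :
    (alex Q L).IsNoetherian S := by
  obtain ⟨hQ, hW⟩ := hW
  have hspace := hM.alex_isSpace hQ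
  refine ⟨hspace, fun h _ f ⟨hfS, hf⟩ hsub => ?_⟩
  obtain ⟨F, rfl, -⟩ := hf.exists_eq_graph
  by_contra! H
  -- `x` is covered before stage `b` but not before stage `a`
  let E : M → M → M → Prop := fun a x b =>
    (∀ n, n < a → ¬ (alex Q L).MemAt (graph F) x n) ∧
      ∃ n, n < b ∧ (alex Q L).MemAt (graph F) x n
  have hE : ∀ i j k, IsSigma S fun v => E (v i) (v j) (v k) := fun i j k =>
    .and hM (IsSigma.ball hM (P := fun n v => ¬ (alex Q L).MemAt (graph F) (v j) n) (.var i)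
        (IsDelta.memAt hM hspace.U_mem hfS (.var (j + 1)) (.var 0)).neg)
      (IsSigma.bex hM (P := fun n v => (alex Q L).MemAt (graph F) (v j) n) (.var k)
        (IsDelta.memAt hM hspace.U_mem hfS (.var (j + 1)) (.var 0)).pos)
  obtain ⟨g, hg, hgE⟩ := hM.exists_choice (P := fun a b => ∃ x, E a x b) (.ex hM (hE 1 0 2)) (by
    intro N
    obtain ⟨x, hx, hN⟩ := H N
    obtain ⟨n, hn⟩ := hsub x hx
    exact ⟨n + 1, x, hN, n, lt_add_one n, hn⟩)
  obtain ⟨b, hb, -, hbg⟩ := hM.exists_iterate hg 0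
  have hbE : ∀ n, ∃ x, E (b n) x (b (n + 1)) := fun n => by
    rw [hbg]
    exact hgE _
  obtain ⟨X, hX, hXE⟩ := hM.exists_choice (P := fun n x => E (b n) x (b (n + 1)))
    (IsSigma.app hM hb (P := fun a v => E a (v 1) (b (v 0 + 1))) (.var 0)
      (IsSigma.app hM hb (P := fun c v => E (v 0) (v 2) c) (.add (.var 1) (.const 1))
        (hE 1 3 0))) hbE
  have hmono : ∀ n m, b n ≤ b (n + m) := fun n => by
    refine hM.induction (IsSigma.app hM hb (P := fun a _ => b n ≤ a) (.add (.const n) (.var 0))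
      (IsBdd.isSigma (.le (.const _) (.var 0)))) (by rw [add_zero]) fun m ih => ih.trans ?_
    obtain ⟨x, hx, k, hk, hxk⟩ := hbE (n + m)
    rw [← add_assoc]
    exact (not_lt.1 fun hlt => hx k hlt hxk).trans hk.le
  have hXQ : ∀ n, X n ∈ Q := fun n => by
    obtain ⟨-, k, -, hk⟩ := hXE n
    obtain ⟨i, -, hi⟩ := hM.memAt_graph.1 hk
    exact (hM.pair_mem_prodSet.1 (hspace.U_subset hi)).1
  obtain ⟨m, n, x, y, hmn, hx, hy, hxy⟩ := hW _ hX (hM.isFun_graph hXQ)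
  rw [hM.pair_mem_graph] at hx hy
  subst hx hy
  obtain ⟨-, k, hk, hm⟩ := hXE m
  obtain ⟨q, hq, hqx⟩ := hM.memAt_graph.1 hm
  obtain ⟨d, rfl⟩ := exists_add_of_le ((hM.lt_iff_add_one_le m n).1 hmn)
  -- The cone of `q` covers `X m` at stage `k < b (m + 1)`, so it also covers the larger point `X (m
  -- + 1 + d)` too early.
  refine (hXE (m + 1 + d)).1 k (hk.trans_le (hmono _ _)) (hM.memAt_graph.2 ⟨q, hq, ?_⟩)
  rw [hM.pair_mem_alex_U hQ] at hqx ⊢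
  exact hQ.trans q (hM.pair_mem_prodSet.1 (hQ.rel_subset hqx)).1 _ (hXQ m) _ (hXQ _) hqx hxy

end

end SOA

theorem proposition3p6 {M : Type*} [CommSemiring M] [LinearOrder M] [IsStrictOrderedRing M]
    (S : Set (Set M)) (hRCA : SOA.IsModelRCA0 M S)
    (Q L : Set M) (hQ : SOA.IsQuasiOrder S Q L) :
    ((SOA.alex Q L).IsNoetherian S → (SOA.upper Q L).IsNoetherian S) ∧
    (SOA.IsWQO S Q L ↔ (SOA.alex Q L).IsNoetherian S) := by
  have := hRCA.canonicallyOrderedAdd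
  exact ⟨hRCA.upper_isNoetherian hQ, hRCA.alex_isNoetherian, hRCA.isWQO_of_alex hQ⟩
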